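/- Let $n \ge 3$ and $g \ge 1$ be integers, and let $W_g = \#^g(S^n \times S^n)$ be the $g$-fold (smooth, oriented) connected sum of copies of $S^n \times S^n$, a closed smooth manifold of dimension $2n$. Then $W_g$ admits a non-trivial smooth action of the Lie group $SU(2)$, i.e. there is a group action of $SU(2)$ on $W_g$ for which the map $SU(2) \times W_g \to W_g$, $(A, x) \mapsto A \cdot x$, is $C^\infty$, and for which $A \cdot x \neq x$ for some $A \in SU(2)$ and $x \in W_g$. -/

import Mathlib

open Set Topology
open scoped Manifold ContDiff

noncomputable section

section Glue

variable {X Y : Type*} [TopologicalSpace X] [TopologicalSpace Y]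

/-- The relation on `X ⊕ Y` that identifies each `x ∈ f.source` with `f x`. -/
def glueRel (f : OpenPartialHomeomorph X Y) : X ⊕ Y → X ⊕ Y → Prop
  | .inl x, .inl x' => x = x'
  | .inl x, .inr y => x ∈ f.source ∧ f x = y
  | .inr y, .inl x => x ∈ f.source ∧ f x = y
  | .inr y, .inr y' => y = y'

def glueSetoid (f : OpenPartialHomeomorph X Y) : Setoid (X ⊕ Y) where
  r := glueRel f
  iseqv := by
    refine ⟨?_, ?_, ?_⟩
    · rintro (x | y) <;> simp [glueRel]
    · rintro (x | y) (x' | y') <;> simp only [glueRel] <;> first | exact Eq.symm | exact id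
    · rintro (x | y) (x' | y') (x'' | y'') <;> simp only [glueRel]
      · rintro rfl h; exact h
      · rintro rfl h; exact h
      · rintro ⟨h, e⟩ ⟨h', e'⟩; exact f.injOn h h' (e.trans e'.symm)
      · rintro h rfl; exact h
      · rintro h rfl; exact h
      · rintro ⟨h, e⟩ ⟨h', e'⟩; exact e.symm.trans e'
      · rintro rfl h; exact h
      · rintro rfl h; exact h

/-- The quotient space of `X ⊕ Y` in which each `x ∈ f.source` is identified with `f x`. -/
def Glue (f : OpenPartialHomeomorph X Y) : Type _ := Quotient (glueSetoid f)

namespace Glue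

variable (f : OpenPartialHomeomorph X Y)

instance : TopologicalSpace (Glue f) :=
  inferInstanceAs (TopologicalSpace (Quotient (glueSetoid f)))

/-- The inclusion of the first piece. -/
def inl (x : X) : Glue f := Quotient.mk (glueSetoid f) (Sum.inl x)

/-- The inclusion of the second piece. -/
def inr (y : Y) : Glue f := Quotient.mk (glueSetoid f) (Sum.inr y)

theorem inl_eq_inr {x : X} {y : Y} : inl f x = inr f y ↔ x ∈ f.source ∧ f x = y :=
  Quotient.eq (r := glueSetoid f)

theorem inl_injective : Function.Injective (inl f) := fun _ _ h =>
  (Quotient.eq (r := glueSetoid f)).1 h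

theorem inr_injective : Function.Injective (inr f) := fun _ _ h =>
  (Quotient.eq (r := glueSetoid f)).1 h

theorem isOpen_iff {s : Set (Glue f)} :
    IsOpen s ↔ IsOpen (inl f ⁻¹' s) ∧ IsOpen (inr f ⁻¹' s) :=
  (isQuotientMap_quot_mk (r := (glueSetoid f).r)).isOpen_preimage.symm.trans isOpen_sum_iff

theorem cases (q : Glue f) : (∃ x, inl f x = q) ∨ ∃ y, inr f y = q := by
  obtain ⟨x | y, rfl⟩ := Quotient.exists_rep q
  · exact Or.inl ⟨x, rfl⟩
  · exact Or.inr ⟨y, rfl⟩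

theorem inr_preimage_inl_image (s : Set X) : inr f ⁻¹' (inl f '' s) = f '' (f.source ∩ s) := by
  ext y
  constructor
  · rintro ⟨x, hx, e⟩
    obtain ⟨h, e⟩ := (inl_eq_inr f).1 e
    exact ⟨x, ⟨h, hx⟩, e⟩
  · rintro ⟨x, ⟨h, hx⟩, e⟩
    exact ⟨x, hx, (inl_eq_inr f).2 ⟨h, e⟩⟩

theorem inl_preimage_inr_image (t : Set Y) : inl f ⁻¹' (inr f '' t) = f.source ∩ f ⁻¹' t := by
  ext x
  constructor
  · rintro ⟨y, hy, e⟩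
    obtain ⟨h, e⟩ := (inl_eq_inr f).1 e.symm
    exact ⟨h, by simpa [e] using hy⟩
  · rintro ⟨h, hx⟩
    exact ⟨f x, hx, ((inl_eq_inr f).2 ⟨h, rfl⟩).symm⟩

theorem isOpenEmbedding_inl : IsOpenEmbedding (inl f) := by
  refine .of_continuous_injective_isOpenMap
    (continuous_def.2 fun s hs => ((isOpen_iff f).1 hs).1) (inl_injective f) fun s hs => ?_
  refine (isOpen_iff f).2 ⟨by rwa [preimage_image_eq _ (inl_injective f)], ?_⟩
  rw [inr_preimage_inl_image]
  exact f.isOpen_image_source_inter hs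

theorem isOpenEmbedding_inr : IsOpenEmbedding (inr f) := by
  refine .of_continuous_injective_isOpenMap
    (continuous_def.2 fun s hs => ((isOpen_iff f).1 hs).2) (inr_injective f) fun s hs => ?_
  refine (isOpen_iff f).2 ⟨?_, by rwa [preimage_image_eq _ (inr_injective f)]⟩
  rw [inl_preimage_inr_image]
  exact f.isOpen_inter_preimage hs

section Charts

theorem contDiffOn_model {H : Type*} [TopologicalSpace H] {E : Type*} [NormedAddCommGroup E]
    [NormedSpace ℝ E] {I : ModelWithCorners ℝ E H} {g : H → H} {s : Set H} (hg : ContMDiffOn I I ∞ g s) :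
    ContDiffOn ℝ ∞ (I ∘ g ∘ I.symm) (I.symm ⁻¹' s ∩ range I) := by
  rw [← contMDiffOn_iff_contDiffOn]
  exact (I.contMDiff.comp_contMDiffOn hg).comp (I.contMDiffOn_symm.mono inter_subset_right)
    inter_subset_left

variable {H : Type*} [TopologicalSpace H] [Nonempty H] [ChartedSpace H X] [ChartedSpace H Y]

open Classical in
/-- The charts of a glued space are the charts of the two pieces. -/
instance : ChartedSpace H (Glue f) where
  atlas := ((fun e => e.lift_openEmbedding (isOpenEmbedding_inl f)) '' atlas H X) ∪
    ((fun e => e.lift_openEmbedding (isOpenEmbedding_inr f)) '' atlas H Y)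
  chartAt q :=
    if h : ∃ x, inl f x = q then
      (chartAt H h.choose).lift_openEmbedding (isOpenEmbedding_inl f)
    else
      (chartAt H ((cases f q).resolve_left h).choose).lift_openEmbedding (isOpenEmbedding_inr f)
  mem_chart_source q := by
    split_ifs with h
    · exact ⟨_, mem_chart_source H _, h.choose_spec⟩
    · exact ⟨_, mem_chart_source H _, ((cases f q).resolve_left h).choose_spec⟩
  chart_mem_atlas q := by
    split_ifs with h
    · exact Or.inl ⟨_, chart_mem_atlas H _, rfl⟩
    · exact Or.inr ⟨_, chart_mem_atlas H _, rfl⟩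

variable {E : Type*} [NormedAddCommGroup E] [NormedSpace ℝ E] {I : ModelWithCorners ℝ E H}

theorem contDiffOn_transition {A B Q : Type*} [TopologicalSpace A] [TopologicalSpace B]
    [TopologicalSpace Q] [ChartedSpace H A] [ChartedSpace H B] [IsManifold I ∞ A]
    [IsManifold I ∞ B] {i : A → Q} {j : B → Q}
    (hi : IsOpenEmbedding i) (hj : IsOpenEmbedding j) (k : A → B) (s : Set A)
    (hk : ContMDiffOn I I ∞ k s) (hij : ∀ a b, i a = j b → a ∈ s ∧ k a = b)
    {e : OpenPartialHomeomorph A H} {e' : OpenPartialHomeomorph B H}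
    (he : e ∈ atlas H A) (he' : e' ∈ atlas H B) :
    ContDiffOn ℝ ∞ (I ∘ (e.lift_openEmbedding hi).symm ≫ₕ (e'.lift_openEmbedding hj) ∘ I.symm)
      (I.symm ⁻¹' ((e.lift_openEmbedding hi).symm ≫ₕ (e'.lift_openEmbedding hj)).source
        ∩ range I) := by
  have h0 : ∀ z ∈ ((e.lift_openEmbedding hi).symm ≫ₕ (e'.lift_openEmbedding hj)).source,
      z ∈ e.target ∧ e.symm z ∈ s ∧ k (e.symm z) ∈ e'.source ∧
        ((e.lift_openEmbedding hi).symm ≫ₕ (e'.lift_openEmbedding hj)) z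
          = e' (k (e.symm z)) := by
    rintro z ⟨hz, hz'⟩
    obtain ⟨b, hb, hbz⟩ : i (e.symm z) ∈ j '' e'.source := hz'
    obtain ⟨h1, h2⟩ := hij _ _ hbz.symm
    refine ⟨hz, h1, h2 ▸ hb, ?_⟩
    change (e'.lift_openEmbedding hj) (i (e.symm z)) = _
    rw [← hbz, OpenPartialHomeomorph.lift_openEmbedding_apply, h2]
  refine contDiffOn_model ?_
  have h1 : ContMDiffOn I I ∞ (e' ∘ k ∘ e.symm)
      ((e.lift_openEmbedding hi).symm ≫ₕ (e'.lift_openEmbedding hj)).source :=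
    (contMDiffOn_of_mem_maximalAtlas
      (IsManifold.subset_maximalAtlas he')).comp
      (hk.comp ((contMDiffOn_symm_of_mem_maximalAtlas
        (IsManifold.subset_maximalAtlas he)).mono fun z hz => (h0 z hz).1)
        fun z hz => (h0 z hz).2.1) fun z hz => (h0 z hz).2.2.1
  exact h1.congr fun z hz => (h0 z hz).2.2.2

theorem isManifold [IsManifold I ∞ X] [IsManifold I ∞ Y]
    (hf : ContMDiffOn I I ∞ f f.source) (hf' : ContMDiffOn I I ∞ f.symm f.target) :
    IsManifold I ∞ (Glue f) := by
  refine isManifold_of_contDiffOn I ∞ _ ?_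
  rintro _ _ (⟨e, he, rfl⟩ | ⟨e, he, rfl⟩) (⟨e', he', rfl⟩ | ⟨e', he', rfl⟩)
  · exact contDiffOn_transition _ _ id univ contMDiffOn_id
      (fun a b h => ⟨trivial, inl_injective f h⟩) he he'
  · exact contDiffOn_transition _ _ f _ hf (fun a b h => (inl_eq_inr f).1 h) he he'
  · refine contDiffOn_transition _ _ f.symm _ hf' (fun a b h => ?_) he he'
    obtain ⟨h1, rfl⟩ := (inl_eq_inr f).1 h.symm
    exact ⟨f.map_source h1, f.left_inv h1⟩
  · exact contDiffOn_transition _ _ id univ contMDiffOn_id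
      (fun a b h => ⟨trivial, inr_injective f h⟩) he he'

/-- An open embedding that lifts charts to charts is a smooth open embedding. -/
theorem contMDiff_of_lift {A Q : Type*} [TopologicalSpace A] [TopologicalSpace Q]
    [ChartedSpace H A] [ChartedSpace H Q] [IsManifold I ∞ A] [IsManifold I ∞ Q] {i : A → Q}
    (hi : IsOpenEmbedding i) (h : ∀ e ∈ atlas H A, e.lift_openEmbedding hi ∈ atlas H Q) :
    ContMDiff I I ∞ i ∧ ∀ g : Q → A, (∀ a, g (i a) = a) → ContMDiffOn I I ∞ g (range i) := by
  constructor
  · intro a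
    have h1 := contMDiffAt_of_mem_maximalAtlas
      (IsManifold.chart_mem_maximalAtlas (I := I) (n := ∞) a) (mem_chart_source H a)
    have h2 := contMDiffAt_symm_of_mem_maximalAtlas (I := I) (n := ∞)
      (IsManifold.subset_maximalAtlas (h _ (chart_mem_atlas H a)))
      (mem_chart_target H a)
    refine (h2.comp a h1).congr_of_eventuallyEq ?_
    filter_upwards [(chartAt H a).open_source.mem_nhds (mem_chart_source H a)] with b hb
    exact congrArg i ((chartAt H a).left_inv hb).symm
  · rintro g hg _ ⟨a, rfl⟩
    have h1 := contMDiffAt_of_mem_maximalAtlas (I := I) (n := ∞)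
      (IsManifold.subset_maximalAtlas (h _ (chart_mem_atlas H a)))
      (mem_image_of_mem i (mem_chart_source H a))
    have h2 := contMDiffAt_symm_of_mem_maximalAtlas
      (IsManifold.chart_mem_maximalAtlas (I := I) (n := ∞) a)
      (x := (chartAt H a).lift_openEmbedding hi (i a))
      (by rw [OpenPartialHomeomorph.lift_openEmbedding_apply]; exact mem_chart_target H a)
    refine ((h2.comp (i a) h1).congr_of_eventuallyEq ?_).contMDiffWithinAt
    filter_upwards [(hi.isOpenMap _ (chartAt H a).open_source).mem_nhds
      (mem_image_of_mem i (mem_chart_source H a))]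
    rintro _ ⟨b, hb, rfl⟩
    rw [Function.comp_apply, OpenPartialHomeomorph.lift_openEmbedding_apply, hg,
      (chartAt H a).left_inv hb]

end Charts

end Glue

end Glue

section ConnectedSum

variable {V : Type*} [NormedAddCommGroup V] [InnerProductSpace ℝ V]

theorem norm_ballInversion {x : V} (hx : 0 < ‖x‖ ∧ ‖x‖ < 1) :
    ‖(‖x‖⁻¹ - 1) • x‖ = 1 - ‖x‖ := by
  have h : 0 ≤ ‖x‖⁻¹ - 1 := sub_nonneg.2 ((one_le_inv₀ hx.1).2 hx.2.le)
  rw [norm_smul, Real.norm_of_nonneg h, sub_mul, inv_mul_cancel₀ hx.1.ne', one_mul]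

theorem contDiffOn_ballInversion :
    ContDiffOn ℝ ∞ (fun x : V => (‖x‖⁻¹ - 1) • x) {x | 0 < ‖x‖ ∧ ‖x‖ < 1} := by
  intro x hx
  have h : ContDiffAt ℝ ∞ (fun x : V => ‖x‖) x := contDiffAt_norm ℝ (norm_pos_iff.1 hx.1)
  exact (((h.inv hx.1.ne').sub contDiffAt_const).smul contDiffAt_id).contDiffWithinAt

theorem ballInversion_mem {x : V} (hx : 0 < ‖x‖ ∧ ‖x‖ < 1) :
    0 < ‖(‖x‖⁻¹ - 1) • x‖ ∧ ‖(‖x‖⁻¹ - 1) • x‖ < 1 := by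
  rw [norm_ballInversion hx]
  exact ⟨by linarith [hx.2], by linarith [hx.1]⟩

theorem ballInversion_involutive {x : V} (hx : 0 < ‖x‖ ∧ ‖x‖ < 1) :
    (‖(‖x‖⁻¹ - 1) • x‖⁻¹ - 1) • (‖x‖⁻¹ - 1) • x = x := by
  rw [norm_ballInversion hx, smul_smul]
  have h1 : ‖x‖ ≠ 0 := hx.1.ne'
  have h2 : 1 - ‖x‖ ≠ 0 := by linarith [hx.2]
  have : ((1 - ‖x‖)⁻¹ - 1) * (‖x‖⁻¹ - 1) = 1 := by
    field_simp
    ring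
  rw [this, one_smul]

variable (V) in
/-- The involution `t • u ↦ (1 - t) • u` (where `‖u‖ = 1` and `0 < t < 1`) of the punctured open
unit ball. -/
def ballInversion : OpenPartialHomeomorph V V where
  toFun x := (‖x‖⁻¹ - 1) • x
  invFun x := (‖x‖⁻¹ - 1) • x
  source := {x | 0 < ‖x‖ ∧ ‖x‖ < 1}
  target := {x | 0 < ‖x‖ ∧ ‖x‖ < 1}
  map_source' _ hx := ballInversion_mem hx
  map_target' _ hx := ballInversion_mem hx
  left_inv' _ hx := ballInversion_involutive hx
  right_inv' _ hx := ballInversion_involutive hx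
  open_source := (isOpen_lt continuous_const continuous_norm).inter
    (isOpen_lt continuous_norm continuous_const)
  open_target := (isOpen_lt continuous_const continuous_norm).inter
    (isOpen_lt continuous_norm continuous_const)
  continuousOn_toFun := contDiffOn_ballInversion.continuousOn
  continuousOn_invFun := contDiffOn_ballInversion.continuousOn

variable {E : Type*} [NormedAddCommGroup E] [NormedSpace ℝ E] {H : Type*} [TopologicalSpace H]

variable (V) in
/-- A smoothly embedded closed disc in `M`: a diffeomorphism from an open neighbourhood of the
closed unit ball of `V` onto an open subset of `M`. -/
structure SmoothDisc (I : ModelWithCorners ℝ E H) (M : Type*) [TopologicalSpace M]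
    [ChartedSpace H M] where
  map : OpenPartialHomeomorph V M
  closedBall_subset : Metric.closedBall 0 1 ⊆ map.source
  contMDiffOn_map : ContMDiffOn 𝓘(ℝ, V) I ∞ map map.source
  contMDiffOn_symm : ContMDiffOn I 𝓘(ℝ, V) ∞ map.symm map.target

variable {I : ModelWithCorners ℝ E H}

namespace SmoothDisc

section

variable {M N : Type*} [TopologicalSpace M] [ChartedSpace H M] [TopologicalSpace N]
  [ChartedSpace H N]

/-- The centre of a disc. -/
def center (D : SmoothDisc V I M) : M := D.map 0

theorem zero_mem (D : SmoothDisc V I M) : (0 : V) ∈ D.map.source :=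
  D.closedBall_subset (Metric.mem_closedBall_self zero_le_one)

/-- The image of a disc under a smooth open embedding. -/
def push (D : SmoothDisc V I M) {j : M → N} (hj : IsOpenEmbedding j) (h : ContMDiff I I ∞ j)
    (h' : ∀ g : N → M, (∀ a, g (j a) = a) → ContMDiffOn I I ∞ g (range j)) :
    SmoothDisc V I N :=
  haveI : Nonempty M := ⟨D.center⟩
  { map := D.map ≫ₕ hj.toOpenPartialHomeomorph j
    closedBall_subset := fun v hv => ⟨D.closedBall_subset hv, trivial⟩
    contMDiffOn_map := h.comp_contMDiffOn (D.contMDiffOn_map.mono inter_subset_left)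
    contMDiffOn_symm :=
      D.contMDiffOn_symm.comp
        ((h' (hj.toOpenPartialHomeomorph j).symm
          fun a => (hj.toOpenPartialHomeomorph j).left_inv (mem_univ a)).mono fun y hy => by
            simpa using hy.1)
        fun y hy => hy.2 }

/-- A disc contained in an open subset, as a disc in that open subset. -/
def restrict (D : SmoothDisc V I M) (U : TopologicalSpace.Opens M)
    (h : ∀ y ∈ D.map.target, y ∈ U) : SmoothDisc V I U :=
  haveI : Nonempty U := ⟨⟨D.center, h _ (D.map.map_source D.zero_mem)⟩⟩
  { map := D.map ≫ₕ (U.openPartialHomeomorphSubtypeCoe this).symm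
    closedBall_subset := fun v hv =>
      ⟨D.closedBall_subset hv, by simpa using h _ (D.map.map_source (D.closedBall_subset hv))⟩
    contMDiffOn_map := by
      intro v hv
      refine (ContMDiffWithinAt.subtypeVal_comp_iff U _ _ _).1 ?_
      refine ((D.contMDiffOn_map v hv.1).mono inter_subset_left).congr (fun w hw => ?_) ?_
      · exact (U.openPartialHomeomorphSubtypeCoe this).right_inv hw.2
      · exact (U.openPartialHomeomorphSubtypeCoe this).right_inv hv.2
    contMDiffOn_symm := D.contMDiffOn_symm.comp
      (contMDiff_subtype_val.contMDiffOn) fun y hy => hy.2 }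

end

variable {M₁ M₂ : Type*} [TopologicalSpace M₁] [ChartedSpace H M₁]
  [TopologicalSpace M₂] [ChartedSpace H M₂]

/-- The gluing map of the connected sum: `D₁ (t • u) ↦ D₂ ((1 - t) • u)`
for `‖u‖ = 1`, `0 < t < 1`. -/
def gluingMap (D₁ : SmoothDisc V I M₁) (D₂ : SmoothDisc V I M₂) : OpenPartialHomeomorph M₁ M₂ :=
  D₁.map.symm ≫ₕ ballInversion V ≫ₕ D₂.map

variable (D₁ : SmoothDisc V I M₁) (D₂ : SmoothDisc V I M₂)

theorem mem_gluingMap_source {x : M₁} :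
    x ∈ (D₁.gluingMap D₂).source ↔ ∃ v : V, 0 < ‖v‖ ∧ ‖v‖ < 1 ∧ D₁.map v = x := by
  constructor
  · rintro ⟨h1, h2, -⟩
    exact ⟨D₁.map.symm x, h2.1, h2.2, D₁.map.right_inv h1⟩
  · rintro ⟨v, h1, h2, rfl⟩
    have hv : v ∈ D₁.map.source := D₁.closedBall_subset (by simpa using h2.le)
    refine ⟨D₁.map.map_source hv, ?_, ?_⟩
    · change 0 < ‖D₁.map.symm (D₁.map v)‖ ∧ ‖D₁.map.symm (D₁.map v)‖ < 1
      rw [D₁.map.left_inv hv]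
      exact ⟨h1, h2⟩
    · change (‖D₁.map.symm (D₁.map v)‖⁻¹ - 1) • D₁.map.symm (D₁.map v) ∈ D₂.map.source
      rw [D₁.map.left_inv hv]
      exact D₂.closedBall_subset (by simpa using (ballInversion_mem ⟨h1, h2⟩).2.le)

theorem gluingMap_apply {v : V} (h : ‖v‖ < 1) :
    D₁.gluingMap D₂ (D₁.map v) = D₂.map ((‖v‖⁻¹ - 1) • v) := by
  have hv : v ∈ D₁.map.source := D₁.closedBall_subset (by simpa using h.le)
  change D₂.map ((‖D₁.map.symm (D₁.map v)‖⁻¹ - 1) • D₁.map.symm (D₁.map v)) = _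
  rw [D₁.map.left_inv hv]

theorem center_not_mem_source : D₁.center ∉ (D₁.gluingMap D₂).source := by
  rw [mem_gluingMap_source]
  rintro ⟨v, h1, h2, h3⟩
  have := D₁.map.injOn (D₁.closedBall_subset (by simpa using h2.le)) D₁.zero_mem h3
  simp [this] at h1

theorem gluingMap_ne_center {x : M₁} (hx : x ∈ (D₁.gluingMap D₂).source) :
    D₁.gluingMap D₂ x ≠ D₂.center := by
  obtain ⟨v, h1, h2, rfl⟩ := (D₁.mem_gluingMap_source D₂).1 hx
  rw [gluingMap_apply _ _ h2]
  intro h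
  have h3 := ballInversion_mem ⟨h1, h2⟩
  have := D₂.map.injOn (D₂.closedBall_subset (by simpa using h3.2.le)) D₂.zero_mem h
  rw [this] at h3
  simp at h3

theorem inl_ne_centers {x : M₁} :
    (Glue.inl (D₁.gluingMap D₂) x ≠ Glue.inl _ D₁.center ∧
      Glue.inl (D₁.gluingMap D₂) x ≠ Glue.inr _ D₂.center) ↔ x ≠ D₁.center := by
  refine ⟨fun h h' => h.1 (congrArg _ h'), fun h => ⟨fun h' => h (Glue.inl_injective _ h'),
    fun h' => ?_⟩⟩
  obtain ⟨h1, h2⟩ := (Glue.inl_eq_inr _).1 h'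
  exact gluingMap_ne_center _ _ h1 h2

theorem inr_ne_centers {y : M₂} :
    (Glue.inr (D₁.gluingMap D₂) y ≠ Glue.inl _ D₁.center ∧
      Glue.inr (D₁.gluingMap D₂) y ≠ Glue.inr _ D₂.center) ↔ y ≠ D₂.center := by
  refine ⟨fun h h' => h.2 (congrArg _ h'), fun h => ⟨fun h' => ?_,
    fun h' => h (Glue.inr_injective _ h')⟩⟩
  exact center_not_mem_source _ _ ((Glue.inl_eq_inr _).1 h'.symm).1

theorem inl_map_eq_inr {v : V} (h : 0 < ‖v‖ ∧ ‖v‖ < 1) :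
    Glue.inl (D₁.gluingMap D₂) (D₁.map v) = Glue.inr _ (D₂.map ((‖v‖⁻¹ - 1) • v)) :=
  (Glue.inl_eq_inr _).2 ⟨(D₁.mem_gluingMap_source D₂).2 ⟨v, h.1, h.2, rfl⟩,
    gluingMap_apply _ _ h.2⟩

theorem inr_map_eq_inl {w : V} (h : 0 < ‖w‖ ∧ ‖w‖ < 1) :
    Glue.inr (D₁.gluingMap D₂) (D₂.map w) = Glue.inl _ (D₁.map ((‖w‖⁻¹ - 1) • w)) := by
  rw [inl_map_eq_inr _ _ (ballInversion_mem h), ballInversion_involutive h]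

theorem map_mem_image_ball (D : SmoothDisc V I M₁) {v : V} (hv : ‖v‖ < 1) {s : Set V}
    (hs : s ⊆ Metric.closedBall 0 1) (h : D.map v ∈ D.map '' s) : v ∈ s := by
  obtain ⟨w, hw, e⟩ := h
  rwa [← D.map.injOn (D.closedBall_subset (hs hw))
    (D.closedBall_subset (by simpa using hv.le)) e]

theorem isClosed_image [T2Space M₁] [FiniteDimensional ℝ V] (D : SmoothDisc V I M₁) :
    IsClosed (D.map '' Metric.closedBall 0 (1 / 2)) :=
  ((isCompact_closedBall 0 (1 / 2)).image_of_continuousOn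
    (D.map.continuousOn.mono ((Metric.closedBall_subset_closedBall (by norm_num)).trans
      D.closedBall_subset))).isClosed

theorem isOpen_image (D : SmoothDisc V I M₁) :
    IsOpen (D.map '' Metric.ball 0 (1 / 2)) :=
  D.map.isOpen_image_of_subset_source Metric.isOpen_ball
    ((Metric.ball_subset_closedBall.trans
      (Metric.closedBall_subset_closedBall (by norm_num))).trans D.closedBall_subset)

theorem inl_mem_range_inr {x : M₁} (hx : x ≠ D₁.center)
    (h : x ∈ D₁.map '' Metric.closedBall 0 (1 / 2)) :
    ∃ w : V, 1 / 2 ≤ ‖w‖ ∧ ‖w‖ < 1 ∧ Glue.inl (D₁.gluingMap D₂) x = Glue.inr _ (D₂.map w) := by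
  obtain ⟨v, hv, rfl⟩ := h
  have hv : ‖v‖ ≤ 1 / 2 := by simpa using hv
  have h0 : 0 < ‖v‖ := norm_pos_iff.2 fun h => hx (by rw [h]; rfl)
  have h1 : 0 < ‖v‖ ∧ ‖v‖ < 1 := ⟨h0, by linarith⟩
  exact ⟨_, by rw [norm_ballInversion h1]; linarith, (ballInversion_mem h1).2,
    inl_map_eq_inr _ _ h1⟩

theorem inr_mem_range_inl {y : M₂} (hy : y ≠ D₂.center)
    (h : y ∈ D₂.map '' Metric.closedBall 0 (1 / 2)) :
    ∃ w : V, 1 / 2 ≤ ‖w‖ ∧ ‖w‖ < 1 ∧ Glue.inr (D₁.gluingMap D₂) y = Glue.inl _ (D₁.map w) := by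
  obtain ⟨v, hv, rfl⟩ := h
  have hv : ‖v‖ ≤ 1 / 2 := by simpa using hv
  have h0 : 0 < ‖v‖ := norm_pos_iff.2 fun h => hy (by rw [h]; rfl)
  have h1 : 0 < ‖v‖ ∧ ‖v‖ < 1 := ⟨h0, by linarith⟩
  exact ⟨_, by rw [norm_ballInversion h1]; linarith, (ballInversion_mem h1).2,
    inr_map_eq_inl _ _ h1⟩

theorem disjoint_images :
    Disjoint (Glue.inl (D₁.gluingMap D₂) '' (D₁.map '' Metric.closedBall 0 (1 / 2))ᶜ)
      (Glue.inr _ '' (D₂.map '' Metric.closedBall 0 (1 / 2))ᶜ) := by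
  rw [Set.disjoint_left]
  rintro _ ⟨x, hx, rfl⟩ ⟨y, hy, e⟩
  obtain ⟨h1, rfl⟩ := (Glue.inl_eq_inr _).1 e.symm
  obtain ⟨v, h2, h3, rfl⟩ := (D₁.mem_gluingMap_source D₂).1 h1
  rw [gluingMap_apply _ _ h3] at hy
  have h4 : 1 / 2 < ‖v‖ := by
    by_contra! h
    exact hx ⟨v, by simpa using h, rfl⟩
  refine hy ⟨_, ?_, rfl⟩
  rw [mem_closedBall_zero_iff, norm_ballInversion ⟨h2, h3⟩]
  linarith

variable [T2Space M₁] [T2Space M₂]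

/-- The underlying open subset of the connected sum: glue `M₁` and `M₂` along the punctured discs
and delete the two centres. -/
def connectedSumOpens : TopologicalSpace.Opens (Glue (D₁.gluingMap D₂)) where
  carrier := {q | q ≠ Glue.inl _ D₁.center ∧ q ≠ Glue.inr _ D₂.center}
  is_open' := by
    refine (Glue.isOpen_iff _).2 ⟨?_, ?_⟩
    · convert! (isOpen_compl_singleton : IsOpen {D₁.center}ᶜ) using 1
      exact Set.ext fun x => inl_ne_centers D₁ D₂
    · convert! (isOpen_compl_singleton : IsOpen {D₂.center}ᶜ) using 1
      exact Set.ext fun y => inr_ne_centers D₁ D₂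

/-- The connected sum of `M₁` and `M₂` along the discs `D₁` and `D₂`: the quotient of
`(M₁ ∖ {D₁ 0}) ⊔ (M₂ ∖ {D₂ 0})` that identifies `D₁ (t • u)` with `D₂ ((1 - t) • u)`
for `‖u‖ = 1` and `0 < t < 1`.
(It inherits orientations of `M₁` and `M₂` for which one of the discs preserves and the other one
reverses the orientation.) -/
abbrev ConnectedSum : Type _ := D₁.connectedSumOpens D₂

variable [FiniteDimensional ℝ V]

instance : T2Space (D₁.ConnectedSum D₂) := by
  suffices h : ∀ p q : Glue (D₁.gluingMap D₂), p ∈ D₁.connectedSumOpens D₂ →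
      q ∈ D₁.connectedSumOpens D₂ → p ≠ q →
      ∃ u v, IsOpen u ∧ IsOpen v ∧ p ∈ u ∧ q ∈ v ∧ Disjoint u v by
    refine ⟨fun p q hpq => ?_⟩
    obtain ⟨u, v, hu, hv, hpu, hqv, hd⟩ := h p q p.2 q.2 fun h => hpq (Subtype.ext h)
    exact ⟨_, _, hu.preimage continuous_subtype_val, hv.preimage continuous_subtype_val,
      hpu, hqv, hd.preimage _⟩
  have sep1 : ∀ x x' : M₁, x ≠ x' → ∃ u v, IsOpen u ∧ IsOpen v ∧
      Glue.inl (D₁.gluingMap D₂) x ∈ u ∧ Glue.inl (D₁.gluingMap D₂) x' ∈ v ∧ Disjoint u v := by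
    intro x x' hx
    obtain ⟨u, v, hu, hv, hxu, hxv, hd⟩ := t2_separation hx
    exact ⟨_, _, (Glue.isOpenEmbedding_inl _).isOpenMap _ hu,
      (Glue.isOpenEmbedding_inl _).isOpenMap _ hv, mem_image_of_mem _ hxu, mem_image_of_mem _ hxv,
      (disjoint_image_iff (Glue.inl_injective _)).2 hd⟩
  have sep2 : ∀ x x' : M₂, x ≠ x' → ∃ u v, IsOpen u ∧ IsOpen v ∧
      Glue.inr (D₁.gluingMap D₂) x ∈ u ∧ Glue.inr (D₁.gluingMap D₂) x' ∈ v ∧ Disjoint u v := by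
    intro x x' hx
    obtain ⟨u, v, hu, hv, hxu, hxv, hd⟩ := t2_separation hx
    exact ⟨_, _, (Glue.isOpenEmbedding_inr _).isOpenMap _ hu,
      (Glue.isOpenEmbedding_inr _).isOpenMap _ hv, mem_image_of_mem _ hxu, mem_image_of_mem _ hxv,
      (disjoint_image_iff (Glue.inr_injective _)).2 hd⟩
  have sep : ∀ (x : M₁) (y : M₂), x ≠ D₁.center → y ≠ D₂.center →
      Glue.inl (D₁.gluingMap D₂) x ≠ Glue.inr _ y → ∃ u v, IsOpen u ∧ IsOpen v ∧
      Glue.inl (D₁.gluingMap D₂) x ∈ u ∧ Glue.inr (D₁.gluingMap D₂) y ∈ v ∧ Disjoint u v := by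
    intro x y hx hy hxy
    by_cases h1 : x ∈ D₁.map '' Metric.closedBall 0 (1 / 2)
    · obtain ⟨w, -, -, e⟩ := inl_mem_range_inr D₁ D₂ hx h1
      rw [e] at hxy ⊢
      exact sep2 _ _ fun h => hxy (congrArg _ h)
    by_cases h2 : y ∈ D₂.map '' Metric.closedBall 0 (1 / 2)
    · obtain ⟨w, -, -, e⟩ := inr_mem_range_inl D₁ D₂ hy h2
      rw [e] at hxy ⊢
      exact sep1 _ _ fun h => hxy (congrArg _ h)
    exact ⟨_, _, (Glue.isOpenEmbedding_inl _).isOpenMap _ (isClosed_image D₁).isOpen_compl,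
      (Glue.isOpenEmbedding_inr _).isOpenMap _ (isClosed_image D₂).isOpen_compl,
      mem_image_of_mem _ h1, mem_image_of_mem _ h2, disjoint_images D₁ D₂⟩
  intro p q hp hq hpq
  obtain ⟨x, rfl⟩ | ⟨y, rfl⟩ := Glue.cases _ p <;>
    obtain ⟨x', rfl⟩ | ⟨y', rfl⟩ := Glue.cases _ q
  · exact sep1 _ _ fun h => hpq (congrArg _ h)
  · exact sep _ _ ((inl_ne_centers _ _).1 hp) ((inr_ne_centers _ _).1 hq) hpq
  · obtain ⟨u, v, hu, hv, h1, h2, hd⟩ :=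
      sep _ _ ((inl_ne_centers _ _).1 hq) ((inr_ne_centers _ _).1 hp) hpq.symm
    exact ⟨v, u, hv, hu, h2, h1, hd.symm⟩
  · exact sep2 _ _ fun h => hpq (congrArg _ h)

instance [CompactSpace M₁] [CompactSpace M₂] : CompactSpace (D₁.ConnectedSum D₂) := by
  refine isCompact_iff_compactSpace.1 (?_ : IsCompact
    (D₁.connectedSumOpens D₂ : Set (Glue (D₁.gluingMap D₂))))
  have h : (D₁.connectedSumOpens D₂ : Set (Glue (D₁.gluingMap D₂))) =
      Glue.inl _ '' (D₁.map '' Metric.ball 0 (1 / 2))ᶜ ∪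
        Glue.inr _ '' (D₂.map '' Metric.ball 0 (1 / 2))ᶜ := by
    have hball : Metric.ball (0 : V) (1 / 2) ⊆ Metric.closedBall 0 1 :=
      Metric.ball_subset_closedBall.trans (Metric.closedBall_subset_closedBall (by norm_num))
    ext q
    constructor
    · intro hq
      obtain ⟨x, rfl⟩ | ⟨y, rfl⟩ := Glue.cases _ q
      · by_cases h1 : x ∈ D₁.map '' Metric.ball 0 (1 / 2)
        · obtain ⟨w, h2, h3, e⟩ := inl_mem_range_inr D₁ D₂ ((inl_ne_centers _ _).1 hq)
            (image_mono Metric.ball_subset_closedBall h1)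
          refine Or.inr ⟨_, fun h4 => ?_, e.symm⟩
          have := map_mem_image_ball D₂ h3 hball h4
          simp at this
          linarith
        · exact Or.inl ⟨x, h1, rfl⟩
      · by_cases h1 : y ∈ D₂.map '' Metric.ball 0 (1 / 2)
        · obtain ⟨w, h2, h3, e⟩ := inr_mem_range_inl D₁ D₂ ((inr_ne_centers _ _).1 hq)
            (image_mono Metric.ball_subset_closedBall h1)
          refine Or.inl ⟨_, fun h4 => ?_, e.symm⟩
          have := map_mem_image_ball D₁ h3 hball h4
          simp at this
          linarith
        · exact Or.inr ⟨y, h1, rfl⟩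
    · rintro (⟨x, hx, rfl⟩ | ⟨y, hy, rfl⟩)
      · exact (inl_ne_centers _ _).2 fun h => hx ⟨0, by simp, h.symm⟩
      · exact (inr_ne_centers _ _).2 fun h => hy ⟨0, by simp, h.symm⟩
  rw [h]
  exact ((isOpen_image D₁).isClosed_compl.isCompact.image
    (Glue.isOpenEmbedding_inl _).continuous).union
    ((isOpen_image D₂).isClosed_compl.isCompact.image (Glue.isOpenEmbedding_inr _).continuous)

end SmoothDisc

namespace SmoothDisc

variable {M₁ M₂ : Type*} [TopologicalSpace M₁] [ChartedSpace H M₁]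
  [TopologicalSpace M₂] [ChartedSpace H M₂] (D₁ : SmoothDisc V I M₁) (D₂ : SmoothDisc V I M₂)
  [Nonempty H] [IsManifold I ∞ M₁] [IsManifold I ∞ M₂]

theorem contMDiffOn_ballInversion :
    ContMDiffOn 𝓘(ℝ, V) 𝓘(ℝ, V) ∞ (ballInversion V) (ballInversion V).source :=
  contMDiffOn_iff_contDiffOn.2 _root_.contDiffOn_ballInversion

instance : IsManifold I ∞ (Glue (D₁.gluingMap D₂)) := by
  refine Glue.isManifold _ ?_ ?_
  · refine D₂.contMDiffOn_map.comp (contMDiffOn_ballInversion.comp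
      (D₁.contMDiffOn_symm.mono fun x hx => hx.1) fun x hx => hx.2.1) fun x hx => hx.2.2
  · refine (D₁.contMDiffOn_map.comp (contMDiffOn_ballInversion.comp
      (D₂.contMDiffOn_symm.mono fun x hx => ?_) fun x hx => ?_) fun x hx => ?_)
    · exact hx.1.1
    · exact hx.1.2
    · exact hx.2

variable [T2Space M₁] [T2Space M₂]

/-- A disc in `M₂` that misses the centre of `D₂`, as a disc in the connected sum. -/
def inConnectedSum (D : SmoothDisc V I M₂) (h : D₂.center ∉ D.map.target) :
    SmoothDisc V I (D₁.ConnectedSum D₂) :=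
  have hi := Glue.contMDiff_of_lift (H := H) (I := I)
    (Glue.isOpenEmbedding_inr (D₁.gluingMap D₂)) fun e he => Or.inr ⟨e, he, rfl⟩
  (D.push (Glue.isOpenEmbedding_inr (D₁.gluingMap D₂)) hi.1 hi.2).restrict _ (by
    rintro _ ⟨⟨y, -, rfl⟩, hq⟩
    refine (inr_ne_centers _ _).2 ?_
    rintro rfl
    refine h ?_
    have : Nonempty M₂ := ⟨D.center⟩
    have h1 := ((Glue.isOpenEmbedding_inr (D₁.gluingMap D₂)).toOpenPartialHomeomorph _).left_inv
      (mem_univ D₂.center)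
    rw [← h1]
    exact hq)

end SmoothDisc

end ConnectedSum

section SpecialUnitary

/-- The group `SU(2)`. -/
abbrev SU2 : Type := Matrix.specialUnitaryGroup (Fin 2) ℂ

namespace SU2

theorem entries (A : SU2) : A.1 1 1 = star (A.1 0 0) ∧ A.1 0 1 = -star (A.1 1 0) ∧
    Complex.normSq (A.1 0 0) + Complex.normSq (A.1 1 0) = 1 := by
  obtain ⟨h1, h2⟩ := Matrix.mem_specialUnitaryGroup_iff.1 A.2
  have h3 : star A.1 * A.1 = 1 := Matrix.mem_unitaryGroup_iff'.1 h1
  have h4 : A.1.adjugate = star A.1 := by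
    have : A.1 * A.1.adjugate = 1 := by rw [Matrix.mul_adjugate, h2, one_smul]
    calc A.1.adjugate = (star A.1 * A.1) * A.1.adjugate := by rw [h3, one_mul]
      _ = star A.1 := by rw [mul_assoc, this, mul_one]
  rw [Matrix.adjugate_fin_two] at h4
  have h5 := congrFun (congrFun h4 0) 0
  have h6 := congrFun (congrFun h4 0) 1
  simp [Matrix.star_apply] at h5 h6
  refine ⟨by simpa using h5, by rw [← neg_eq_iff_eq_neg]; simpa using h6, ?_⟩
  have h7 := congrFun (congrFun h3 0) 0
  simp [Matrix.mul_apply, Matrix.star_apply, ← Complex.normSq_eq_conj_mul_self] at h7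
  exact_mod_cast h7

/-- The homeomorphism from the unit sphere of `ℝ⁴` to `SU(2)` that sends `(a, b, c, d)` to the
matrix with first column `(a + b i, c + d i)`. -/
def sphereHomeo : Metric.sphere (0 : EuclideanSpace ℝ (Fin 4)) 1 ≃ₜ SU2 where
  toFun x := ⟨!![⟨x.1 0, x.1 1⟩, ⟨-x.1 2, x.1 3⟩; ⟨x.1 2, x.1 3⟩, ⟨x.1 0, -x.1 1⟩], by
    have h : x.1 0 ^ 2 + x.1 1 ^ 2 + x.1 2 ^ 2 + x.1 3 ^ 2 = 1 := by
      have := EuclideanSpace.real_norm_sq_eq x.1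
      rw [norm_eq_of_mem_sphere, Fin.sum_univ_four] at this
      linarith
    refine Matrix.mem_specialUnitaryGroup_iff.2 ⟨Matrix.mem_unitaryGroup_iff.2 ?_, ?_⟩
    · ext i j
      fin_cases i <;> fin_cases j <;> apply Complex.ext <;>
        simp [Matrix.mul_apply, Matrix.star_apply] <;> linarith
    · rw [Matrix.det_fin_two]
      apply Complex.ext <;> simp <;> linarith⟩
  invFun A := ⟨!₂[(A.1 0 0).re, (A.1 0 0).im, (A.1 1 0).re, (A.1 1 0).im], by
    have h := (entries A).2.2
    rw [Complex.normSq_apply, Complex.normSq_apply] at h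
    rw [mem_sphere_zero_iff_norm, ← sq_eq_sq₀ (norm_nonneg _) zero_le_one,
      EuclideanSpace.real_norm_sq_eq, Fin.sum_univ_four]
    simp
    linarith⟩
  left_inv x := by
    ext i
    fin_cases i <;> simp
  right_inv A := by
    obtain ⟨h1, h2, -⟩ := entries A
    ext i j
    fin_cases i <;> fin_cases j <;> apply Complex.ext <;> simp [h1, h2]
  continuous_toFun := by
    refine Continuous.subtype_mk (continuous_matrix fun i j => ?_) _
    have h : ∀ k : Fin 4, Continuous
        fun x : Metric.sphere (0 : EuclideanSpace ℝ (Fin 4)) 1 => x.1 k := fun k => by fun_prop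
    have h2 : ∀ k l : Fin 4, Continuous
        fun x : Metric.sphere (0 : EuclideanSpace ℝ (Fin 4)) 1 => (⟨x.1 k, x.1 l⟩ : ℂ) :=
      fun k l => Complex.equivRealProdCLM.symm.continuous.comp ((h k).prodMk (h l))
    have h3 : Continuous
        fun x : Metric.sphere (0 : EuclideanSpace ℝ (Fin 4)) 1 => (⟨-x.1 2, x.1 3⟩ : ℂ) :=
      Complex.equivRealProdCLM.symm.continuous.comp ((h 2).neg.prodMk (h 3))
    have h4 : Continuous
        fun x : Metric.sphere (0 : EuclideanSpace ℝ (Fin 4)) 1 => (⟨x.1 0, -x.1 1⟩ : ℂ) :=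
      Complex.equivRealProdCLM.symm.continuous.comp ((h 0).prodMk (h 1).neg)
    fin_cases i <;> fin_cases j
    · exact h2 0 1
    · exact h3
    · exact h2 2 3
    · exact h4
  continuous_invFun := by
    refine Continuous.subtype_mk ((PiLp.continuous_toLp 2 _).comp (continuous_pi fun k => ?_)) _
    have h : ∀ i j : Fin 2, Continuous fun A : SU2 => A.1 i j := fun i j =>
      (continuous_apply_apply i j).comp continuous_subtype_val
    fin_cases k
    · exact Complex.continuous_re.comp (h 0 0)
    · exact Complex.continuous_im.comp (h 0 0)
    · exact Complex.continuous_re.comp (h 1 0)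
    · exact Complex.continuous_im.comp (h 1 0)

/-- The smooth structure of `SU(2)`, transported from the unit sphere of `ℝ⁴`. -/
instance : ChartedSpace (EuclideanSpace ℝ (Fin 3)) SU2 where
  atlas := (fun e => e.lift_openEmbedding sphereHomeo.isOpenEmbedding) ''
    atlas (EuclideanSpace ℝ (Fin 3)) (Metric.sphere (0 : EuclideanSpace ℝ (Fin 4)) 1)
  chartAt A := (chartAt _ (sphereHomeo.symm A)).lift_openEmbedding sphereHomeo.isOpenEmbedding
  mem_chart_source A := ⟨_, mem_chart_source _ _, sphereHomeo.apply_symm_apply A⟩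
  chart_mem_atlas _ := ⟨_, chart_mem_atlas _ _, rfl⟩

instance : IsManifold (𝓡 3) ∞ SU2 where
  compatible := by
    rintro _ _ ⟨e, he, rfl⟩ ⟨e', he', rfl⟩
    rw [OpenPartialHomeomorph.lift_openEmbedding_trans]
    exact (inferInstance : IsManifold (𝓡 3) ∞
      (Metric.sphere (0 : EuclideanSpace ℝ (Fin 4)) 1)).compatible he he'

end SU2

end SpecialUnitary

section Wg

/-- The unit sphere `S^n` of `ℝ^(n+1)`. -/
abbrev Sph (n : ℕ) : Type := Metric.sphere (0 : EuclideanSpace ℝ (Fin (n + 1))) 1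

/-- The point `(1 + ‖x‖²)⁻¹ (2x, ε (1 - ‖x‖²))` of `ℝ^(n+1) = ℝ^n × ℝ`. -/
def stereoPoint {n : ℕ} (ε : ℝ) (x : EuclideanSpace ℝ (Fin n)) : EuclideanSpace ℝ (Fin (n + 1)) :=
  (1 + ‖x‖ ^ 2)⁻¹ • WithLp.toLp 2 (Fin.snoc (α := fun _ => ℝ) (fun i => 2 * x i) (ε * (1 - ‖x‖ ^ 2)))

theorem stereoPoint_castSucc {n : ℕ} (ε : ℝ) (x : EuclideanSpace ℝ (Fin n)) (i : Fin n) :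
    stereoPoint ε x i.castSucc = (1 + ‖x‖ ^ 2)⁻¹ * (2 * x i) := by
  simp [stereoPoint]

theorem stereoPoint_last {n : ℕ} (ε : ℝ) (x : EuclideanSpace ℝ (Fin n)) :
    stereoPoint ε x (Fin.last n) = (1 + ‖x‖ ^ 2)⁻¹ * (ε * (1 - ‖x‖ ^ 2)) := by
  simp [stereoPoint]

theorem stereoPoint_mem {n : ℕ} {ε : ℝ} (hε : ε * ε = 1) (x : EuclideanSpace ℝ (Fin n)) :
    stereoPoint ε x ∈ Metric.sphere (0 : EuclideanSpace ℝ (Fin (n + 1))) 1 := by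
  have h : (1 + ‖x‖ ^ 2) ≠ 0 := by positivity
  rw [mem_sphere_zero_iff_norm, ← sq_eq_sq₀ (norm_nonneg _) zero_le_one,
    EuclideanSpace.real_norm_sq_eq, Fin.sum_univ_castSucc]
  simp only [stereoPoint_castSucc, stereoPoint_last, mul_pow, ← Finset.mul_sum]
  rw [← EuclideanSpace.real_norm_sq_eq x, show ε ^ 2 = 1 by rw [sq, hε]]
  field_simp
  ring

theorem contDiff_stereoPoint {n : ℕ} (ε : ℝ) :
    ContDiff ℝ ∞ (stereoPoint (n := n) ε) := by
  have hn : ContDiff ℝ ∞ fun x : EuclideanSpace ℝ (Fin n) => ‖x‖ ^ 2 := contDiff_norm_sq ℝ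
  have hi : ContDiff ℝ ∞ fun x : EuclideanSpace ℝ (Fin n) => (1 + ‖x‖ ^ 2)⁻¹ :=
    (contDiff_const.add hn).inv fun x => by positivity
  rw [contDiff_euclidean]
  refine Fin.lastCases ?_ fun i => ?_
  · simp only [stereoPoint_last]
    exact hi.mul (contDiff_const.mul (contDiff_const.sub hn))
  · simp only [stereoPoint_castSucc]
    exact hi.mul (contDiff_const.mul (by fun_prop))

theorem sphere_sum {n : ℕ} (p : Sph n) :
    ∑ i : Fin n, p.1 i.castSucc ^ 2 + p.1 (Fin.last n) ^ 2 = 1 := by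
  have := EuclideanSpace.real_norm_sq_eq p.1
  rw [norm_eq_of_mem_sphere, Fin.sum_univ_castSucc] at this
  linarith

/-- For `ε = ±1`, the inverse of the stereographic projection of `S^n` from the point `(0, -ε)`
to the hyperplane `ℝ^n`, as a map from `ℝ^n` to the complement of that point. -/
def stereo (n : ℕ) {ε : ℝ} (hε : ε * ε = 1) :
    OpenPartialHomeomorph (EuclideanSpace ℝ (Fin n)) (Sph n) where
  toFun x := ⟨stereoPoint ε x, stereoPoint_mem hε x⟩
  invFun p := (1 + ε * p.1 (Fin.last n))⁻¹ • WithLp.toLp 2 fun i => p.1 (Fin.castSucc i)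
  source := univ
  target := {p | 1 + ε * p.1 (Fin.last n) ≠ 0}
  map_source' x _ := by
    have h : (1 + ‖x‖ ^ 2) ≠ 0 := by positivity
    change 1 + ε * stereoPoint ε x (Fin.last n) ≠ 0
    rw [stereoPoint_last]
    have : 1 + ε * ((1 + ‖x‖ ^ 2)⁻¹ * (ε * (1 - ‖x‖ ^ 2))) = 2 * (1 + ‖x‖ ^ 2)⁻¹ := by
      field_simp
      linear_combination (1 - ‖x‖ ^ 2) * hε
    rw [this]
    positivity
  map_target' _ _ := trivial
  left_inv' x _ := by
    have h : (1 + ‖x‖ ^ 2) ≠ 0 := by positivity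
    have : 1 + ε * ((1 + ‖x‖ ^ 2)⁻¹ * (ε * (1 - ‖x‖ ^ 2))) = 2 * (1 + ‖x‖ ^ 2)⁻¹ := by
      field_simp
      linear_combination (1 - ‖x‖ ^ 2) * hε
    ext i
    simp only [stereoPoint_last, stereoPoint_castSucc, this, PiLp.smul_apply, smul_eq_mul]
    field_simp
  right_inv' p hp := by
    have hp : 1 + ε * p.1 (Fin.last n) ≠ 0 := hp
    have h := sphere_sum p
    set q : EuclideanSpace ℝ (Fin n) :=
      (1 + ε * p.1 (Fin.last n))⁻¹ • WithLp.toLp 2 fun i => p.1 (Fin.castSucc i) with hq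
    have hi : ∀ i, q i = (1 + ε * p.1 (Fin.last n))⁻¹ * p.1 (Fin.castSucc i) := fun i => by
      simp [hq]
    have hq2 : ‖q‖ ^ 2 = ((1 + ε * p.1 (Fin.last n))⁻¹) ^ 2 * (1 - p.1 (Fin.last n) ^ 2) := by
      rw [EuclideanSpace.real_norm_sq_eq]
      simp only [hi, mul_pow, ← Finset.mul_sum]
      linear_combination (1 + ε * p.1 (Fin.last n))⁻¹ ^ 2 * h
    have h1 : 1 + ‖q‖ ^ 2 = 2 * (1 + ε * p.1 (Fin.last n))⁻¹ := by
      rw [hq2]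
      field_simp
      linear_combination (p.1 (Fin.last n) ^ 2) * hε
    have h2 : 1 - ‖q‖ ^ 2 = 2 * (ε * p.1 (Fin.last n)) * (1 + ε * p.1 (Fin.last n))⁻¹ := by
      linear_combination -h1 - 2 * (mul_inv_cancel₀ hp)
    ext i
    change stereoPoint ε q i = p.1 i
    refine Fin.lastCases ?_ (fun i => ?_) i
    · rw [stereoPoint_last, h1, h2]
      field_simp
      linear_combination (p.1 (Fin.last n)) * hε
    · rw [stereoPoint_castSucc, h1, hi]
      field_simp
  open_source := isOpen_univ
  open_target := by
    refine isOpen_ne.preimage (f := fun p : Sph n => 1 + ε * p.1 (Fin.last n)) ?_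
    fun_prop
  continuousOn_toFun := ((contDiff_stereoPoint ε).continuous.subtype_mk _).continuousOn
  continuousOn_invFun := by
    refine ContinuousOn.smul (ContinuousOn.inv₀ ?_ fun p hp => hp) (Continuous.continuousOn ?_) <;>
      fun_prop

theorem contMDiff_stereo (n : ℕ) {ε : ℝ} (hε : ε * ε = 1) :
    ContMDiff (𝓡 n) (𝓡 n) ∞ (stereo n hε) :=
  have := Fact.mk (@finrank_euclideanSpace_fin ℝ _ (n + 1))
  (contDiff_stereoPoint ε).contMDiff.codRestrict_sphere _

theorem contMDiffOn_stereo_symm (n : ℕ) {ε : ℝ} (hε : ε * ε = 1) :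
    ContMDiffOn (𝓡 n) (𝓡 n) ∞ (stereo n hε).symm (stereo n hε).target := by
  have h : ContDiffOn ℝ ∞ (fun p : EuclideanSpace ℝ (Fin (n + 1)) =>
      (1 + ε * p (Fin.last n))⁻¹ • (WithLp.toLp 2 fun i => p (Fin.castSucc i) :
        EuclideanSpace ℝ (Fin n))) {p | 1 + ε * p (Fin.last n) ≠ 0} := by
    refine ContDiffOn.smul (ContDiffOn.inv (ContDiff.contDiffOn ?_) fun p hp => hp)
      (ContDiff.contDiffOn ?_)
    · fun_prop
    · rw [contDiff_euclidean]
      intro i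
      fun_prop
  have := Fact.mk (@finrank_euclideanSpace_fin ℝ _ (n + 1))
  exact h.contMDiffOn.comp contMDiff_coe_sphere.contMDiffOn fun p hp => hp

/-- `ℝ^n ⊕ ℝ^n` with the Euclidean norm. -/
abbrev EucSq (n : ℕ) : Type := WithLp 2 (EuclideanSpace ℝ (Fin n) × EuclideanSpace ℝ (Fin n))

/-- The model space of `S^n × S^n`. -/
abbrev ModelSq (n : ℕ) : Type :=
  ModelProd (EuclideanSpace ℝ (Fin n)) (EuclideanSpace ℝ (Fin n))

/-- The disc `(x, y) ↦ (σ x, σ_ε y)` in `S^n × S^n`, where `σ` and `σ_ε` are the inverse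
stereographic projections from `(0, -1)` and from `(0, -ε)`. As `σ` and `σ_{-1}` differ by the
reflection of `S^n` in the last coordinate, the discs for `ε = 1` and `ε = -1` have opposite
orientations. -/
def sphereProdDisc (n : ℕ) {ε : ℝ} (hε : ε * ε = 1) :
    SmoothDisc (EucSq n) ((𝓡 n).prod (𝓡 n)) (Sph n × Sph n) where
  map := (WithLp.prodContinuousLinearEquiv 2 ℝ (EuclideanSpace ℝ (Fin n))
      (EuclideanSpace ℝ (Fin n))).toHomeomorph.toOpenPartialHomeomorph ≫ₕ
    (stereo n (one_mul (1 : ℝ))).prod (stereo n hε)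
  closedBall_subset := fun _ _ => ⟨trivial, trivial, trivial⟩
  contMDiffOn_map := by
    let L := WithLp.prodContinuousLinearEquiv 2 ℝ (EuclideanSpace ℝ (Fin n))
      (EuclideanSpace ℝ (Fin n))
    have h1 : ContDiff ℝ ∞ fun z : EucSq n => z.fst := contDiff_fst.comp L.contDiff
    have h2 : ContDiff ℝ ∞ fun z : EucSq n => z.snd := contDiff_snd.comp L.contDiff
    exact (((contMDiff_stereo n _).comp h1.contMDiff).prodMk
      ((contMDiff_stereo n hε).comp h2.contMDiff)).contMDiffOn
  contMDiffOn_symm := by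
    let L := WithLp.prodContinuousLinearEquiv 2 ℝ (EuclideanSpace ℝ (Fin n))
      (EuclideanSpace ℝ (Fin n))
    have h := L.symm.contDiff (n := ∞)
    exact h.contMDiff.comp_contMDiffOn
      (((contMDiffOn_stereo_symm n (one_mul (1 : ℝ))).comp contMDiffOn_fst
        fun p hp => hp.1.1).prodMk_space
      ((contMDiffOn_stereo_symm n hε).comp contMDiffOn_snd fun p hp => hp.1.2))

theorem center_not_mem_target (n : ℕ) :
    (sphereProdDisc n (one_mul (1 : ℝ))).center ∉
      (sphereProdDisc n (ε := -1) (by norm_num)).map.target := by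
  rintro ⟨⟨-, h⟩, -⟩
  refine h ?_
  change 1 + -1 * stereoPoint 1 (0 : EuclideanSpace ℝ (Fin n)) (Fin.last n) = 0
  simp [stereoPoint_last]

/-- A closed smooth manifold modelled on that of `S^n × S^n`, with an embedded disc. -/
structure ManifoldWithDisc (n : ℕ) : Type 1 where
  carrier : Type
  [topology : TopologicalSpace carrier]
  [t2 : T2Space carrier]
  [compact : CompactSpace carrier]
  [charts : ChartedSpace (ModelSq n) carrier]
  [smooth : IsManifold ((𝓡 n).prod (𝓡 n)) ∞ carrier]
  disc : SmoothDisc (EucSq n) ((𝓡 n).prod (𝓡 n)) carrier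

attribute [instance] ManifoldWithDisc.topology ManifoldWithDisc.t2 ManifoldWithDisc.compact
  ManifoldWithDisc.charts ManifoldWithDisc.smooth

/-- The connected sum of `k + 1` copies of `S^n × S^n`. The next copy is glued in along its disc
`(x, y) ↦ (σ x, σ y)` and the disc `(x, y) ↦ (σ x, σ_{-1} y)` of the last copy; these have opposite
orientations, so that this is the connected sum of oriented manifolds. -/
def iteratedSum (n : ℕ) : ℕ → ManifoldWithDisc n
  | 0 =>
    { carrier := Sph n × Sph n
      disc := sphereProdDisc n (ε := -1) (by norm_num) }
  | k + 1 =>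
    { carrier := (iteratedSum n k).disc.ConnectedSum (sphereProdDisc n (one_mul (1 : ℝ)))
      disc := SmoothDisc.inConnectedSum _ _ (sphereProdDisc n (ε := -1) (by norm_num))
        (center_not_mem_target n) }

/-- The manifold `W_g = #^g (S^n × S^n)`, for `g ≥ 1`. -/
abbrev W (n g : ℕ) : Type := (iteratedSum n (g - 1)).carrier

end Wg

end

/-! The group `SU(2)` acts on `ℝ³` through its double cover of `SO(3)`, hence orthogonally on `ℝ^n =
ℝ³ × ℝ^(n-3)`. Suspending gives an action on `S^n ⊂ ℝ^n × ℝ` that fixes both poles, and the diagonal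
action on `S^n × S^n` then fixes the centres of the discs used to form `W_g`. In the stereographic
coordinates of these discs the action is linear: it is `ρ ⊕ ρ` for one and the same orthogonal
representation `ρ`, whichever pole is the centre (`suspend_stereoPoint`,
`isEquivariant_sphereProdDisc`).

The connected sum glues punctured balls by a radial map `v ↦ (‖v‖⁻¹ - 1) • v`, which commutes with
every linear isometry (`gluingMap_smul`). So the actions on the two summands agree on the overlap
and define a smooth action on the connected sum (`exists_mulAction_connectedSum`). By induction this
reaches every number of summands, the equivariance of the distinguished disc being part of the
induction hypothesis (`exists_mulAction_iteratedSum`).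

The action is non-trivial because it contains a disc on which it is the non-trivial linear
representation `ρ ⊕ ρ` (`IsEquivariant.exists_smul_ne`, `rep_diagI_ne`). Smoothness comes down to
the entries of the rotation being polynomials in the coordinates of `S³ ≅ SU(2)` (`contMDiff_rep`).
-/

noncomputable section

/-! ### Smooth actions on glued spaces -/

namespace Glue

variable {X Y G : Type*} [TopologicalSpace X] [TopologicalSpace Y] [Monoid G] [MulAction G X]
  [MulAction G Y]

/-- The action on a glued space that restricts to given actions on the pieces, when the gluing map
is equivariant. -/
@[reducible]
def mulAction (f : OpenPartialHomeomorph X Y)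
    (hf : ∀ (A : G) (x : X), x ∈ f.source → A • x ∈ f.source ∧ f (A • x) = A • f x) :
    MulAction G (Glue f) where
  smul A := Quotient.map (Sum.map (A • ·) (A • ·)) (by
    -- Well-definedness on the quotient: only the two mixed cases use the equivariance of `f`, and
    -- they are mirror images.
    rintro (x | y) (x' | y') h
    · exact congrArg (A • ·) h
    · obtain ⟨h1, rfl⟩ := h
      exact hf A x h1
    · obtain ⟨h1, rfl⟩ := h
      exact hf A x' h1
    · exact congrArg (A • ·) h)
  one_smul q := by
    obtain ⟨x, rfl⟩ | ⟨y, rfl⟩ := cases f q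
    · exact congrArg (inl f) (one_smul G x)
    · exact congrArg (inr f) (one_smul G y)
  mul_smul A B q := by
    obtain ⟨x, rfl⟩ | ⟨y, rfl⟩ := cases f q
    · exact congrArg (inl f) (mul_smul A B x)
    · exact congrArg (inr f) (mul_smul A B y)

variable {E' : Type*} [NormedAddCommGroup E'] [NormedSpace ℝ E'] {H' : Type*} [TopologicalSpace H']
  {J : ModelWithCorners ℝ E' H'} [TopologicalSpace G] [ChartedSpace H' G]
  {E : Type*} [NormedAddCommGroup E] [NormedSpace ℝ E] {H : Type*} [TopologicalSpace H]
  {I : ModelWithCorners ℝ E H}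

/-- A smooth action on `A` yields smoothness on the image of `A` under a smooth equivariant open
embedding. -/
theorem contMDiffAt_smul_of_lift [Nonempty H] {A Q : Type*} [TopologicalSpace A] [TopologicalSpace Q]
    [ChartedSpace H A] [ChartedSpace H Q] [IsManifold I ∞ A] [IsManifold I ∞ Q] [MulAction G A]
    [SMul G Q] [ContMDiffSMul J I ∞ G A] {i : A → Q} (hi : IsOpenEmbedding i)
    (h : ∀ e ∈ atlas H A, e.lift_openEmbedding hi ∈ atlas H Q)
    (hs : ∀ (g : G) (a : A), i (g • a) = g • i a) (g : G) (a : A) :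
    ContMDiffAt (J.prod I) I ∞ (fun p : G × Q => p.1 • p.2) (g, i a) := by
  have : Nonempty A := ⟨a⟩
  obtain ⟨h1, h2⟩ := contMDiff_of_lift (I := I) hi h
  have h3 := h2 (Function.invFun i) (Function.leftInverse_invFun hi.injective)
  -- Over the open set `range i` the action is the one on `A` conjugated by `i`. The values of
  -- `Function.invFun i` off the range do not matter, since the claim is local.
  have h4 : ContMDiffAt (J.prod I) I ∞
      (fun p : G × Q => i (p.1 • Function.invFun i p.2)) (g, i a) := by
    have h5 : ContMDiff (J.prod I) I ∞ fun p : G × A => p.1 • p.2 := contMDiff_smul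
    refine (h1.comp h5).contMDiffAt.comp (g, i a)
      (f := fun p : G × Q => (p.1, Function.invFun i p.2)) (contMDiffAt_fst.prodMk ?_)
    exact ContMDiffAt.comp (I := J.prod I) (g, i a)
      ((h3 (i a) (mem_range_self a)).contMDiffAt (hi.isOpen_range.mem_nhds (mem_range_self a)))
      (contMDiffAt_snd (I := J))
  refine h4.congr_of_eventuallyEq ?_
  filter_upwards [(hi.isOpen_range.preimage continuous_snd).mem_nhds
    (mem_range_self (f := i) a : (g, i a) ∈ Prod.snd ⁻¹' range i)]
  rintro ⟨g', _⟩ ⟨b, rfl⟩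
  change g' • i b = i (g' • Function.invFun i (i b))
  rw [Function.leftInverse_invFun hi.injective b, hs]

/-- Smoothness is local, and the images of the two pieces are open and cover the glued space. -/
theorem contMDiffSMul [Nonempty H] [ChartedSpace H X] [ChartedSpace H Y] [IsManifold I ∞ X]
    [IsManifold I ∞ Y] [ContMDiffSMul J I ∞ G X] [ContMDiffSMul J I ∞ G Y]
    (f : OpenPartialHomeomorph X Y) [IsManifold I ∞ (Glue f)]
    (hf : ∀ (A : G) (x : X), x ∈ f.source → A • x ∈ f.source ∧ f (A • x) = A • f x) :
    letI := mulAction f hf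
    ContMDiffSMul J I ∞ G (Glue f) := by
  let := mulAction f hf
  refine ⟨fun ⟨g, q⟩ => ?_⟩
  obtain ⟨x, rfl⟩ | ⟨y, rfl⟩ := cases f q
  · exact contMDiffAt_smul_of_lift (H := H) (isOpenEmbedding_inl f) (fun e he => Or.inl ⟨e, he, rfl⟩)
      (fun _ _ => rfl) g x
  · exact contMDiffAt_smul_of_lift (H := H) (isOpenEmbedding_inr f) (fun e he => Or.inr ⟨e, he, rfl⟩)
      (fun _ _ => rfl) g y

end Glue

/-! ### Smooth actions on invariant open subsets -/

section Opens

variable {G M : Type*} [Monoid G] [MulAction G M] [TopologicalSpace M]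

/-- The action on an invariant open subset. -/
@[reducible]
def opensMulAction (U : TopologicalSpace.Opens M) (hU : ∀ (A : G) (x : M), x ∈ U → A • x ∈ U) :
    MulAction G U where
  smul A x := ⟨A • x.1, hU A x.1 x.2⟩
  one_smul x := Subtype.ext (one_smul G x.1)
  mul_smul A B x := Subtype.ext (mul_smul A B x.1)

theorem contMDiffSMul_opens {E' : Type*} [NormedAddCommGroup E'] [NormedSpace ℝ E'] {H' : Type*}
    [TopologicalSpace H'] {J : ModelWithCorners ℝ E' H'} [TopologicalSpace G] [ChartedSpace H' G]
    {E : Type*} [NormedAddCommGroup E] [NormedSpace ℝ E] {H : Type*} [TopologicalSpace H]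
    {I : ModelWithCorners ℝ E H} [ChartedSpace H M] [ContMDiffSMul J I ∞ G M]
    (U : TopologicalSpace.Opens M) (hU : ∀ (A : G) (x : M), x ∈ U → A • x ∈ U) :
    letI := opensMulAction U hU
    ContMDiffSMul J I ∞ G U := by
  let := opensMulAction U hU
  refine ⟨(ContMDiff.subtypeVal_comp_iff U _).1 ?_⟩
  exact (contMDiff_smul (G := G) (M := M) (I := J) (I' := I) (n := ∞)).comp
    (contMDiff_fst.prodMk (contMDiff_subtype_val.comp contMDiff_snd))

end Opens

/-! ### Equivariant discs and equivariant connected sums -/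

namespace SmoothDisc

variable {V : Type*} [NormedAddCommGroup V] [InnerProductSpace ℝ V]
  {E : Type*} [NormedAddCommGroup E] [NormedSpace ℝ E] {H : Type*} [TopologicalSpace H]
  {I : ModelWithCorners ℝ E H} {G : Type*} (ρ : G → V →ₗᵢ[ℝ] V)

/-- A disc on whose interior the action is given by the linear isometries `ρ`. -/
def IsEquivariant {M : Type*} [TopologicalSpace M] [ChartedSpace H M] [SMul G M]
    (D : SmoothDisc V I M) : Prop :=
  ∀ (A : G) (v : V), ‖v‖ < 1 → D.map (ρ A v) = A • D.map v

variable {ρ}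

/-- Linear maps fix the origin. This is what lets the action survive the deletion of the centres. -/
theorem IsEquivariant.smul_center {M : Type*} [TopologicalSpace M] [ChartedSpace H M] [SMul G M]
    {D : SmoothDisc V I M} (h : D.IsEquivariant ρ) (A : G) : A • D.center = D.center := by
  have := h A 0 (by simp)
  rw [map_zero] at this
  exact this.symm

/-- The source of non-triviality: a linear map that moves `v` also moves its small multiples, and
the disc is injective on the unit ball. -/
theorem IsEquivariant.exists_smul_ne {M : Type*} [TopologicalSpace M] [ChartedSpace H M] [SMul G M]
    {D : SmoothDisc V I M} (h : D.IsEquivariant ρ) {A : G} {v : V} (hv : ρ A v ≠ v) :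
    ∃ x : M, A • x ≠ x := by
  have h0 : v ≠ 0 := by
    rintro rfl
    exact hv (map_zero _)
  have h1 : 0 < ‖v‖ := norm_pos_iff.2 h0
  -- With this scale `c • v` has norm `1/2`, inside the ball where equivariance is available.
  set c : ℝ := (2 * ‖v‖)⁻¹ with hc
  have hc0 : 0 < c := by positivity
  have h2 : ‖c • v‖ < 1 := by
    rw [norm_smul, Real.norm_of_nonneg hc0.le, hc]
    field_simp
    norm_num
  refine ⟨D.map (c • v), fun e => hv ?_⟩
  rw [← h A _ h2] at e
  have h3 := D.map.injOn (D.closedBall_subset (mem_closedBall_zero_iff.2 (((ρ A).norm_map _).trans_le h2.le)))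
    (D.closedBall_subset (mem_closedBall_zero_iff.2 h2.le)) e
  rw [map_smul] at h3
  exact smul_right_injective V hc0.ne' h3

variable [Group G] {M₁ M₂ : Type*} [TopologicalSpace M₁] [ChartedSpace H M₁]
  [TopologicalSpace M₂] [ChartedSpace H M₂] [MulAction G M₁] [MulAction G M₂]
  {D₁ : SmoothDisc V I M₁} {D₂ : SmoothDisc V I M₂}

/-- In disc coordinates the gluing map rescales `v` by a factor that depends on `‖v‖` alone, so it
commutes with the isometry `ρ A`. It is essential that both discs carry the same `ρ`. -/
theorem gluingMap_smul (h₁ : D₁.IsEquivariant ρ) (h₂ : D₂.IsEquivariant ρ) (A : G) (x : M₁)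
    (hx : x ∈ (D₁.gluingMap D₂).source) :
    A • x ∈ (D₁.gluingMap D₂).source ∧ D₁.gluingMap D₂ (A • x) = A • D₁.gluingMap D₂ x := by
  obtain ⟨v, hv0, hv1, rfl⟩ := (D₁.mem_gluingMap_source D₂).1 hx
  have hA : ‖ρ A v‖ = ‖v‖ := (ρ A).norm_map v
  rw [← h₁ A v hv1]
  refine ⟨(D₁.mem_gluingMap_source D₂).2 ⟨ρ A v, by rwa [hA], by rwa [hA], rfl⟩, ?_⟩
  rw [gluingMap_apply _ _ (hA.trans_lt hv1), gluingMap_apply _ _ hv1, hA, ← map_smul,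
    h₂ A _ (ballInversion_mem ⟨hv0, hv1⟩).2]

theorem smul_mem_connectedSumOpens [T2Space M₁] [T2Space M₂] (h₁ : D₁.IsEquivariant ρ)
    (h₂ : D₂.IsEquivariant ρ) (A : G) (q : Glue (D₁.gluingMap D₂))
    (hq : q ∈ D₁.connectedSumOpens D₂) :
    letI := Glue.mulAction _ (gluingMap_smul h₁ h₂)
    A • q ∈ D₁.connectedSumOpens D₂ := by
  let := Glue.mulAction _ (gluingMap_smul h₁ h₂)
  have e₁ : A • Glue.inl (D₁.gluingMap D₂) D₁.center = Glue.inl _ D₁.center :=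
    congrArg (Glue.inl (D₁.gluingMap D₂)) (h₁.smul_center A)
  have e₂ : A • Glue.inr (D₁.gluingMap D₂) D₂.center = Glue.inr _ D₂.center :=
    congrArg (Glue.inr (D₁.gluingMap D₂)) (h₂.smul_center A)
  -- Each group element acts injectively and fixes both centres, so no other point can be sent to a
  -- centre.
  exact ⟨fun h => hq.1 (MulAction.injective A (h.trans e₁.symm)),
    fun h => hq.2 (MulAction.injective A (h.trans e₂.symm))⟩

/-- The connected sum along equivariant discs carries a smooth action, and an equivariant disc of
the second summand remains equivariant. -/
theorem exists_mulAction_connectedSum {E' : Type*} [NormedAddCommGroup E'] [NormedSpace ℝ E']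
    {H' : Type*} [TopologicalSpace H'] {J : ModelWithCorners ℝ E' H'} [TopologicalSpace G]
    [ChartedSpace H' G] [T2Space M₁] [T2Space M₂] [Nonempty H] [IsManifold I ∞ M₁]
    [IsManifold I ∞ M₂] [ContMDiffSMul J I ∞ G M₁] [ContMDiffSMul J I ∞ G M₂]
    (h₁ : D₁.IsEquivariant ρ) (h₂ : D₂.IsEquivariant ρ) (D : SmoothDisc V I M₂)
    (hD : D.IsEquivariant ρ) (h : D₂.center ∉ D.map.target) :
    ∃ _ : MulAction G (D₁.ConnectedSum D₂), ContMDiffSMul J I ∞ G (D₁.ConnectedSum D₂) ∧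
      (inConnectedSum D₁ D₂ D h).IsEquivariant ρ := by
  let := Glue.mulAction _ (gluingMap_smul h₁ h₂)
  have := Glue.contMDiffSMul (J := J) (I := I) _ (gluingMap_smul h₁ h₂)
  refine ⟨opensMulAction _ (smul_mem_connectedSumOpens h₁ h₂), contMDiffSMul_opens _ _, ?_⟩
  intro A v hv
  -- `restrict` composes with a partial inverse of the inclusion of the open subset. The bound on
  -- `w` keeps the point where this really is an inverse, so that forgetting the subtype gives back
  -- the pushed disc.
  have hmap : ∀ w : V, ‖w‖ < 1 →
      ((inConnectedSum D₁ D₂ D h).map w).1 = Glue.inr (D₁.gluingMap D₂) (D.map w) := fun w hw =>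
    TopologicalSpace.Opens.openPartialHomeomorphSubtypeCoe _ _ |>.right_inv
      (((inConnectedSum D₁ D₂ D h).closedBall_subset
        (by simpa using hw.le : w ∈ Metric.closedBall 0 1)).2)
  refine Subtype.ext ?_
  rw [hmap _ (((ρ A).norm_map v).trans_lt hv), hD A v hv]
  change _ = A • ((inConnectedSum D₁ D₂ D h).map v).1
  rw [hmap v hv]
  rfl

end SmoothDisc

/-! ### Suspended orthogonal actions on the sphere -/

section Suspension

variable {n : ℕ}

/-- The first `n` coordinates of a vector of `ℝ^(n+1)`. -/
def initCoords (p : EuclideanSpace ℝ (Fin (n + 1))) : EuclideanSpace ℝ (Fin n) :=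
  WithLp.toLp 2 fun i => p (Fin.castSucc i)

/-- The isometry `(x, t) ↦ (f x, t)` of `ℝ^(n+1) = ℝ^n × ℝ`. -/
def suspend (f : EuclideanSpace ℝ (Fin n) →ₗᵢ[ℝ] EuclideanSpace ℝ (Fin n))
    (p : EuclideanSpace ℝ (Fin (n + 1))) : EuclideanSpace ℝ (Fin (n + 1)) :=
  WithLp.toLp 2 (Fin.snoc (α := fun _ => ℝ) (fun i => f (initCoords p) i) (p (Fin.last n)))

theorem suspend_castSucc (f : EuclideanSpace ℝ (Fin n) →ₗᵢ[ℝ] EuclideanSpace ℝ (Fin n))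
    (p : EuclideanSpace ℝ (Fin (n + 1))) (i : Fin n) :
    suspend f p i.castSucc = f (initCoords p) i := by
  simp [suspend]

theorem suspend_last (f : EuclideanSpace ℝ (Fin n) →ₗᵢ[ℝ] EuclideanSpace ℝ (Fin n))
    (p : EuclideanSpace ℝ (Fin (n + 1))) : suspend f p (Fin.last n) = p (Fin.last n) := by
  simp [suspend]

theorem initCoords_suspend (f : EuclideanSpace ℝ (Fin n) →ₗᵢ[ℝ] EuclideanSpace ℝ (Fin n))
    (p : EuclideanSpace ℝ (Fin (n + 1))) : initCoords (suspend f p) = f (initCoords p) := by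
  ext i
  exact suspend_castSucc f p i

theorem norm_sq_eq_initCoords (p : EuclideanSpace ℝ (Fin (n + 1))) :
    ‖p‖ ^ 2 = ‖initCoords p‖ ^ 2 + p (Fin.last n) ^ 2 := by
  rw [EuclideanSpace.real_norm_sq_eq, EuclideanSpace.real_norm_sq_eq, Fin.sum_univ_castSucc]
  rfl

theorem norm_suspend (f : EuclideanSpace ℝ (Fin n) →ₗᵢ[ℝ] EuclideanSpace ℝ (Fin n))
    (p : EuclideanSpace ℝ (Fin (n + 1))) : ‖suspend f p‖ = ‖p‖ := by
  rw [← sq_eq_sq₀ (norm_nonneg _) (norm_nonneg _), norm_sq_eq_initCoords, norm_sq_eq_initCoords p,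
    initCoords_suspend, f.norm_map, suspend_last]

theorem suspend_one (p : EuclideanSpace ℝ (Fin (n + 1))) : suspend 1 p = p := by
  ext i
  refine Fin.lastCases ?_ (fun i => ?_) i
  · exact suspend_last _ _
  · exact suspend_castSucc _ _ _

theorem suspend_mul (f g : EuclideanSpace ℝ (Fin n) →ₗᵢ[ℝ] EuclideanSpace ℝ (Fin n))
    (p : EuclideanSpace ℝ (Fin (n + 1))) : suspend (f * g) p = suspend f (suspend g p) := by
  ext i
  refine Fin.lastCases ?_ (fun i => ?_) i
  · simp only [suspend_last]
  · simp only [suspend_castSucc, initCoords_suspend, LinearIsometry.coe_mul, Function.comp_apply]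

/-- The first `n` coordinates of `stereoPoint ε x` are a radial factor times `x`, and the last one
depends only on `‖x‖`. The sign `ε` plays no part, so the projections from both poles linearise the
suspended action in the same way. -/
theorem suspend_stereoPoint (f : EuclideanSpace ℝ (Fin n) →ₗᵢ[ℝ] EuclideanSpace ℝ (Fin n)) (ε : ℝ)
    (x : EuclideanSpace ℝ (Fin n)) : suspend f (stereoPoint ε x) = stereoPoint ε (f x) := by
  have h : initCoords (stereoPoint ε x) = ((1 + ‖x‖ ^ 2)⁻¹ * 2) • x := by
    ext i
    simp only [initCoords, stereoPoint_castSucc, PiLp.smul_apply, smul_eq_mul, mul_assoc]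
  ext i
  refine Fin.lastCases ?_ (fun i => ?_) i
  · simp only [suspend_last, stereoPoint_last, f.norm_map]
  · simp only [suspend_castSucc, stereoPoint_castSucc, f.norm_map, h, map_smul, PiLp.smul_apply,
      smul_eq_mul, mul_assoc]

variable {G : Type*} [Monoid G]
  (ρ : G →* (EuclideanSpace ℝ (Fin n) →ₗᵢ[ℝ] EuclideanSpace ℝ (Fin n)))

/-- The action on `S^n` that is given by an orthogonal representation on `ℝ^n` and fixes the last
coordinate. -/
@[reducible]
def sphMulAction : MulAction G (Sph n) where
  smul A p := ⟨suspend (ρ A) p.1, by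
    rw [mem_sphere_zero_iff_norm, norm_suspend, norm_eq_of_mem_sphere]⟩
  one_smul p := Subtype.ext (by
    change suspend (ρ 1) p.1 = p.1
    rw [map_one, suspend_one])
  mul_smul A B p := Subtype.ext (by
    change suspend (ρ (A * B)) p.1 = suspend (ρ A) (suspend (ρ B) p.1)
    rw [map_mul, suspend_mul])

theorem stereo_map_smul {ε : ℝ} (hε : ε * ε = 1) (A : G) (x : EuclideanSpace ℝ (Fin n)) :
    letI := sphMulAction ρ
    stereo n hε (ρ A x) = A • stereo n hε x :=
  Subtype.ext (suspend_stereoPoint (ρ A) ε x).symm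

variable {E : Type*} [NormedAddCommGroup E] [NormedSpace ℝ E] {H : Type*} [TopologicalSpace H]
  {J : ModelWithCorners ℝ E H} [TopologicalSpace G] [ChartedSpace H G]
  [IsManifold J ∞ G]

theorem contMDiffSMul_sph (hρ : ContMDiff (J.prod (𝓡 n)) (𝓡 n) ∞
      fun p : G × EuclideanSpace ℝ (Fin n) => ρ p.1 p.2) :
    letI := sphMulAction ρ
    ContMDiffSMul J (𝓡 n) ∞ G (Sph n) := by
  let := sphMulAction ρ
  have := Fact.mk (@finrank_euclideanSpace_fin ℝ _ (n + 1))
  have hc : ContMDiff (J.prod (𝓡 n)) 𝓘(ℝ, EuclideanSpace ℝ (Fin (n + 1))) ∞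
      fun p : G × Sph n => p.2.1 := contMDiff_coe_sphere.comp contMDiff_snd
  have hi : ContDiff ℝ ∞ (initCoords (n := n)) := by
    rw [contDiff_euclidean]
    intro i
    simp only [initCoords]
    fun_prop
  have h1 : ContMDiff (J.prod (𝓡 n)) (𝓡 n) ∞
      fun p : G × Sph n => ρ p.1 (initCoords p.2.1) :=
    hρ.comp (contMDiff_fst.prodMk (hi.contMDiff.comp hc))
  -- `L` reassembles the suspended point: `suspend (ρ A) p = L (ρ A (initCoords p), p)`. This
  -- separates the dependence on `A`, controlled by `hρ`, from a smooth map of Euclidean spaces.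
  let L : EuclideanSpace ℝ (Fin n) × EuclideanSpace ℝ (Fin (n + 1)) →
      EuclideanSpace ℝ (Fin (n + 1)) := fun q =>
    WithLp.toLp 2 (Fin.snoc (α := fun _ => ℝ) (fun i => q.1 i) (q.2 (Fin.last n)))
  have hL : ContDiff ℝ ∞ L := by
    rw [contDiff_euclidean]
    refine Fin.lastCases ?_ fun i => ?_
    · simp only [L, Fin.snoc_last]
      fun_prop
    · simp only [L, Fin.snoc_castSucc]
      fun_prop
  exact ⟨(hL.contMDiff.comp (h1.prodMk_space hc)).codRestrict_sphere _⟩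

end Suspension

/-! ### The diagonal action on products of spheres and on their iterated connected sums -/

section DiagonalAction

variable {n : ℕ}

/-- The isometry `(x, y) ↦ (f x, f y)`. -/
def diagIsometry (f : EuclideanSpace ℝ (Fin n) →ₗᵢ[ℝ] EuclideanSpace ℝ (Fin n)) :
    EucSq n →ₗᵢ[ℝ] EucSq n where
  toFun z := WithLp.toLp 2 (f z.fst, f z.snd)
  map_add' z w := by
    refine (WithLp.equiv 2 _).injective (Prod.ext ?_ ?_) <;> simp
  map_smul' c z := by
    refine (WithLp.equiv 2 _).injective (Prod.ext ?_ ?_) <;> simp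
  norm_map' z := by
    change ‖(WithLp.toLp 2 (f z.fst, f z.snd) : EucSq n)‖ = ‖z‖
    rw [← sq_eq_sq₀ (norm_nonneg _) (norm_nonneg _), WithLp.prod_norm_sq_eq_of_L2,
      WithLp.prod_norm_sq_eq_of_L2 z]
    simp

variable {G : Type*} [Group G]
  (ρ : G →* (EuclideanSpace ℝ (Fin n) →ₗᵢ[ℝ] EuclideanSpace ℝ (Fin n)))

theorem isEquivariant_sphereProdDisc {ε : ℝ} (hε : ε * ε = 1) :
    letI := sphMulAction ρ
    (sphereProdDisc n hε).IsEquivariant fun A => diagIsometry (ρ A) := by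
  let := sphMulAction ρ
  exact fun A v _ => Prod.ext (stereo_map_smul ρ (one_mul 1) A v.fst) (stereo_map_smul ρ hε A v.snd)

variable {E : Type*} [NormedAddCommGroup E] [NormedSpace ℝ E] {H : Type*} [TopologicalSpace H]
  {J : ModelWithCorners ℝ E H} [TopologicalSpace G] [ChartedSpace H G]
  [IsManifold J ∞ G]

/-- Equivariance of the disc is carried along because the next summand is attached there. -/
theorem exists_mulAction_iteratedSum (hρ : ContMDiff (J.prod (𝓡 n)) (𝓡 n) ∞
      fun p : G × EuclideanSpace ℝ (Fin n) => ρ p.1 p.2) (k : ℕ) :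
    ∃ _ : MulAction G (iteratedSum n k).carrier,
      ContMDiffSMul J ((𝓡 n).prod (𝓡 n)) ∞ G (iteratedSum n k).carrier ∧
        (iteratedSum n k).disc.IsEquivariant fun A => diagIsometry (ρ A) := by
  let := sphMulAction ρ
  have := contMDiffSMul_sph ρ hρ
  induction k with
  | zero =>
    exact ⟨(inferInstance : MulAction G (Sph n × Sph n)),
      (inferInstance : ContMDiffSMul J ((𝓡 n).prod (𝓡 n)) ∞ G (Sph n × Sph n)),
      isEquivariant_sphereProdDisc ρ _⟩
  | succ k ih =>
    obtain ⟨_, _, hD⟩ := ih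
    -- The new copy is glued along its disc with `ε = 1` and hands on the one with `ε = -1`; both
    -- are equivariant for the same representation.
    exact SmoothDisc.exists_mulAction_connectedSum hD (isEquivariant_sphereProdDisc ρ _) _
      (isEquivariant_sphereProdDisc ρ _) (center_not_mem_target n)

end DiagonalAction

/-! ### The representation of `SU(2)` through rotations of `ℝ³` -/

namespace SU2

/-- The matrix of the conjugation action of the unit quaternion `w + x i + y j + z k` on the
imaginary quaternions. -/
def quatRotation (w x y z : ℝ) : Matrix (Fin 3) (Fin 3) ℝ :=
  !![w ^ 2 + x ^ 2 - y ^ 2 - z ^ 2, 2 * (x * y - w * z), 2 * (x * z + w * y);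
    2 * (x * y + w * z), w ^ 2 - x ^ 2 + y ^ 2 - z ^ 2, 2 * (y * z - w * x);
    2 * (x * z - w * y), 2 * (y * z + w * x), w ^ 2 - x ^ 2 - y ^ 2 + z ^ 2]

/-- The rotation of `ℝ³` that covers an element of `SU(2)`. -/
def rotation (A : SU2) : Matrix (Fin 3) (Fin 3) ℝ :=
  quatRotation (A.1 0 0).re (A.1 0 0).im (A.1 1 0).re (-(A.1 1 0).im)

theorem rotation_one : rotation 1 = 1 := by
  ext i j
  fin_cases i <;> fin_cases j <;> simp [rotation, quatRotation]

/-- A matrix with first column `(a, c)` corresponds to the quaternion `a + j c`, whence the minus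
sign in `rotation`, and matrix products become quaternion products. `entries` expresses the second
column of `A` by its first; what is left is a polynomial identity valid for all quaternions, of any
norm. -/
theorem rotation_mul (A B : SU2) : rotation (A * B) = rotation A * rotation B := by
  obtain ⟨h1, h2, -⟩ := entries A
  have h3 : (A * B).1 0 0 = A.1 0 0 * B.1 0 0 - star (A.1 1 0) * B.1 1 0 := by
    simp [Matrix.mul_apply, Fin.sum_univ_two, h2, sub_eq_add_neg]
  have h4 : (A * B).1 1 0 = A.1 1 0 * B.1 0 0 + star (A.1 0 0) * B.1 1 0 := by
    simp [Matrix.mul_apply, Fin.sum_univ_two, h1]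
  ext i j
  rw [rotation, h3, h4]
  fin_cases i <;> fin_cases j <;>
    simp [rotation, quatRotation, Matrix.mul_apply, Fin.sum_univ_three] <;> ring

theorem sum_sq_rotation (A : SU2) (x y z : ℝ) :
    (rotation A 0 0 * x + rotation A 0 1 * y + rotation A 0 2 * z) ^ 2 +
      (rotation A 1 0 * x + rotation A 1 1 * y + rotation A 1 2 * z) ^ 2 +
      (rotation A 2 0 * x + rotation A 2 1 * y + rotation A 2 2 * z) ^ 2 =
    x ^ 2 + y ^ 2 + z ^ 2 := by
  have h := (entries A).2.2
  rw [Complex.normSq_apply, Complex.normSq_apply] at h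
  simp only [rotation, quatRotation]
  generalize (A.1 0 0).re = a at *
  generalize (A.1 0 0).im = b at *
  generalize (A.1 1 0).re = c at *
  generalize (A.1 1 0).im = d at *
  simp
  -- For a quaternion of squared norm `N` the matrix multiplies squared lengths by `N ^ 2`, and `N ^
  -- 2 - 1 = (N + 1) * (N - 1)`.
  linear_combination (x ^ 2 + y ^ 2 + z ^ 2) * ((a * a + b * b + (c * c + d * d)) + 1) * h

variable (k : ℕ)

/-- The rotation `R` of the first three coordinates. -/
def rotateFirst (R : Matrix (Fin 3) (Fin 3) ℝ) (v : EuclideanSpace ℝ (Fin (k + 3))) :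
    EuclideanSpace ℝ (Fin (k + 3)) :=
  WithLp.toLp 2 (Fin.cons (R 0 0 * v 0 + R 0 1 * v 1 + R 0 2 * v 2)
    (Fin.cons (R 1 0 * v 0 + R 1 1 * v 1 + R 1 2 * v 2)
      (Fin.cons (R 2 0 * v 0 + R 2 1 * v 1 + R 2 2 * v 2) fun i => v i.succ.succ.succ)))

variable {k}

theorem rotateFirst_zero (R : Matrix (Fin 3) (Fin 3) ℝ) (v : EuclideanSpace ℝ (Fin (k + 3))) :
    rotateFirst k R v 0 = R 0 0 * v 0 + R 0 1 * v 1 + R 0 2 * v 2 := rfl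

theorem rotateFirst_one (R : Matrix (Fin 3) (Fin 3) ℝ) (v : EuclideanSpace ℝ (Fin (k + 3))) :
    rotateFirst k R v 1 = R 1 0 * v 0 + R 1 1 * v 1 + R 1 2 * v 2 := rfl

theorem rotateFirst_two (R : Matrix (Fin 3) (Fin 3) ℝ) (v : EuclideanSpace ℝ (Fin (k + 3))) :
    rotateFirst k R v 2 = R 2 0 * v 0 + R 2 1 * v 1 + R 2 2 * v 2 := rfl

theorem rotateFirst_succ (R : Matrix (Fin 3) (Fin 3) ℝ) (v : EuclideanSpace ℝ (Fin (k + 3)))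
    (i : Fin k) : rotateFirst k R v i.succ.succ.succ = v i.succ.succ.succ := rfl

theorem forall_fin_add_three {P : Fin (k + 3) → Prop} (h0 : P 0) (h1 : P 1) (h2 : P 2)
    (h : ∀ i : Fin k, P i.succ.succ.succ) (i : Fin (k + 3)) : P i :=
  Fin.cases h0 (Fin.cases h1 (Fin.cases h2 h)) i

theorem norm_rotateFirst (A : SU2) (v : EuclideanSpace ℝ (Fin (k + 3))) :
    ‖rotateFirst k (rotation A) v‖ = ‖v‖ := by
  have h : ∀ w : EuclideanSpace ℝ (Fin (k + 3)),
      ‖w‖ ^ 2 = w 0 ^ 2 + w 1 ^ 2 + w 2 ^ 2 + ∑ i : Fin k, w i.succ.succ.succ ^ 2 := fun w => by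
    rw [EuclideanSpace.real_norm_sq_eq, Fin.sum_univ_succ, Fin.sum_univ_succ, Fin.sum_univ_succ,
      ← add_assoc, ← add_assoc]
    rfl
  rw [← sq_eq_sq₀ (norm_nonneg _) (norm_nonneg _), h, h v]
  simp only [rotateFirst_zero, rotateFirst_one, rotateFirst_two, rotateFirst_succ,
    sum_sq_rotation]

variable (k)

/-- The representation of `SU(2)` on `ℝ^(k+3) = ℝ³ × ℝ^k` by rotations of the first factor. -/
def rep : SU2 →* (EuclideanSpace ℝ (Fin (k + 3)) →ₗᵢ[ℝ] EuclideanSpace ℝ (Fin (k + 3))) where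
  toFun A :=
    { toFun := rotateFirst k (rotation A)
      map_add' v w := by
        ext i
        revert i
        refine forall_fin_add_three ?_ ?_ ?_ fun i => ?_ <;>
          simp only [PiLp.add_apply, rotateFirst_zero, rotateFirst_one, rotateFirst_two,
            rotateFirst_succ] <;> ring
      map_smul' c v := by
        ext i
        revert i
        refine forall_fin_add_three ?_ ?_ ?_ fun i => ?_ <;>
          simp only [PiLp.smul_apply, smul_eq_mul, rotateFirst_zero, rotateFirst_one,
            rotateFirst_two, rotateFirst_succ, RingHom.id_apply] <;> ring
      norm_map' := norm_rotateFirst A }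
  map_one' := by
    ext v i
    change rotateFirst k (rotation 1) v i = v i
    rw [rotation_one]
    revert i
    refine forall_fin_add_three ?_ ?_ ?_ fun i => ?_ <;>
      simp [rotateFirst_zero, rotateFirst_one, rotateFirst_two, rotateFirst_succ]
  map_mul' A B := by
    ext v i
    change rotateFirst k (rotation (A * B)) v i =
      rotateFirst k (rotation A) (rotateFirst k (rotation B) v) i
    rw [rotation_mul]
    revert i
    refine forall_fin_add_three ?_ ?_ ?_ fun i => ?_ <;>
      simp only [rotateFirst_zero, rotateFirst_one, rotateFirst_two, rotateFirst_succ,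
        Matrix.mul_apply, Fin.sum_univ_three] <;> ring

/-- The charts of `SU(2)` are those of `S³` transported by `sphereHomeo`, so in corresponding charts
this map is the identity. -/
theorem contMDiff_sphereHomeo_symm : ContMDiff (𝓡 3) (𝓡 3) ∞ sphereHomeo.symm := by
  intro A
  have h := contMDiffAt_symm_of_mem_maximalAtlas (I := 𝓡 3) (n := ∞)
    (IsManifold.chart_mem_maximalAtlas (sphereHomeo.symm A))
    (mem_chart_target (EuclideanSpace ℝ (Fin 3)) (sphereHomeo.symm A))
  have h' := contMDiffAt_of_mem_maximalAtlas (I := 𝓡 3) (n := ∞)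
    (IsManifold.chart_mem_maximalAtlas A) (mem_chart_source (EuclideanSpace ℝ (Fin 3)) A)
  have e : ∀ x : Metric.sphere (0 : EuclideanSpace ℝ (Fin 4)) 1,
      chartAt (EuclideanSpace ℝ (Fin 3)) A (sphereHomeo x) =
        chartAt (EuclideanSpace ℝ (Fin 3)) (sphereHomeo.symm A) x := fun x =>
    OpenPartialHomeomorph.lift_openEmbedding_apply _ _
  have eA := e (sphereHomeo.symm A)
  rw [sphereHomeo.apply_symm_apply] at eA
  rw [← eA] at h
  refine (h.comp A h').congr_of_eventuallyEq ?_
  filter_upwards [(chartAt (EuclideanSpace ℝ (Fin 3)) A).open_source.mem_nhds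
    (mem_chart_source _ A)]
  rintro _ ⟨x, hx, rfl⟩
  rw [sphereHomeo.symm_apply_apply, Function.comp_apply, e, (chartAt _ _).left_inv hx]

theorem rep_apply (A : SU2) (v : EuclideanSpace ℝ (Fin (k + 3))) :
    rep k A v = rotateFirst k (rotation A) v := rfl

/-- Exhibits the rotation as a polynomial map of `ℝ⁴` restricted to the sphere, so that its
smoothness can be checked on `ℝ⁴`. -/
theorem rotation_eq (A : SU2) :
    rotation A = quatRotation ((sphereHomeo.symm A).1 0) ((sphereHomeo.symm A).1 1)
      ((sphereHomeo.symm A).1 2) (-(sphereHomeo.symm A).1 3) := rfl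

theorem contMDiff_comp_sphereHomeo_symm {W₁ W₂ : Type*} [NormedAddCommGroup W₁] [NormedSpace ℝ W₁]
    [NormedAddCommGroup W₂] [NormedSpace ℝ W₂] {F : EuclideanSpace ℝ (Fin 4) × W₁ → W₂}
    (hF : ContDiff ℝ ∞ F) : ContMDiff ((𝓡 3).prod 𝓘(ℝ, W₁)) 𝓘(ℝ, W₂) ∞
      fun p : SU2 × W₁ => F ((sphereHomeo.symm p.1).1, p.2) := by
  have := Fact.mk (@finrank_euclideanSpace_fin ℝ _ (3 + 1))
  have hs : ContMDiff (𝓡 3) 𝓘(ℝ, EuclideanSpace ℝ (Fin 4)) ∞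
      fun A : SU2 => (sphereHomeo.symm A).1 :=
    contMDiff_coe_sphere.comp contMDiff_sphereHomeo_symm
  exact hF.contMDiff.comp ((hs.comp contMDiff_fst).prodMk_space contMDiff_snd)

theorem contDiff_rotateFirst_quatRotation :
    ContDiff ℝ ∞ fun q : EuclideanSpace ℝ (Fin 4) × EuclideanSpace ℝ (Fin (k + 3)) =>
      rotateFirst k (quatRotation (q.1 0) (q.1 1) (q.1 2) (-q.1 3)) q.2 := by
  rw [contDiff_euclidean]
  refine forall_fin_add_three ?_ ?_ ?_ fun i => ?_
  · simp only [rotateFirst_zero, quatRotation, Matrix.of_apply, Matrix.cons_val]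
    fun_prop
  · simp only [rotateFirst_one, quatRotation, Matrix.of_apply, Matrix.cons_val]
    fun_prop
  · simp only [rotateFirst_two, quatRotation, Matrix.of_apply, Matrix.cons_val]
    fun_prop
  · simp only [rotateFirst_succ]
    fun_prop

theorem contMDiff_rep : ContMDiff ((𝓡 3).prod (𝓡 (k + 3))) (𝓡 (k + 3)) ∞
    fun p : SU2 × EuclideanSpace ℝ (Fin (k + 3)) => rep k p.1 p.2 := by
  simp only [rep_apply, rotation_eq]
  exact contMDiff_comp_sphereHomeo_symm (contDiff_rotateFirst_quatRotation k)

/-- The diagonal matrix with entries `i` and `-i`. -/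
def diagI : SU2 :=
  ⟨!![Complex.I, 0; 0, -Complex.I], Matrix.mem_specialUnitaryGroup_iff.2
    ⟨Matrix.mem_unitaryGroup_iff.2 (by
      ext i j
      fin_cases i <;> fin_cases j <;> simp [Matrix.mul_apply, Matrix.star_apply]),
      by simp [Matrix.det_fin_two]⟩⟩

/-- `diagI` is the quaternion `i`, whose rotation is the half-turn `diag(1, -1, -1)`; it negates the
second basis vector. -/
theorem rep_diagI_ne :
    rep k diagI (EuclideanSpace.single 1 1) ≠ EuclideanSpace.single (1 : Fin (k + 3)) (1 : ℝ) := by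
  intro h
  have h1 : rotateFirst k (rotation diagI) (EuclideanSpace.single 1 1) 1 = _ :=
    congrArg (fun v : EuclideanSpace ℝ (Fin (k + 3)) => v 1) h
  rw [rotateFirst_one] at h1
  -- Numerals in `Fin (k + 3)` are reduced modulo `k + 3`, so the two indices are compared after the
  -- reduction.
  have h2 : (2 : Fin (k + 3)) ≠ 1 := by
    rw [Ne, Fin.ext_iff]
    change ¬2 % (k + 3) = 1 % (k + 3)
    rw [Nat.mod_eq_of_lt (by omega), Nat.mod_eq_of_lt (by omega)]
    omega
  simp [rotation, quatRotation, diagI, h2] at h1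
  norm_num at h1

end SU2

theorem mainTheorem8 (n g : ℕ) (hn : 3 ≤ n) (hg : 1 ≤ g) :
    ∃ _ : MulAction SU2 (W n g),
      ContMDiffSMul (𝓡 3) ((𝓡 n).prod (𝓡 n)) ∞ SU2 (W n g) ∧
        ∃ (A : SU2) (x : W n g), A • x ≠ x := by
  -- The condition `3 ≤ n` makes room for the factor `ℝ³` on which `SU(2)` rotates.
  obtain ⟨k, rfl⟩ : ∃ k, n = k + 3 := ⟨n - 3, by omega⟩
  obtain ⟨a, ha, hD⟩ := exists_mulAction_iteratedSum (SU2.rep k) (SU2.contMDiff_rep k) (g - 1)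
  refine ⟨a, ha, SU2.diagI, hD.exists_smul_ne
    -- Under the diagonal representation, a vector moved in the first factor already suffices.
    (v := WithLp.toLp 2 (EuclideanSpace.single 1 1, 0)) fun h => ?_⟩
  exact SU2.rep_diagI_ne k (congrArg (fun z : EucSq (k + 3) => z.fst) h)

end
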